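/- Conventions. All graphs are finite and simple. The maximal cliques of a graph $S$ are its maximal complete subgraphs. A set $A\subseteq V(S)$ is the inner hub of $S$ if $V(K)\cap V(K')=A$ for any two different maximal cliques $K,K'$ of $S$, and $A=V(S)$ if $S$ is complete. Two graphs $S,T$ with inner hubs are glued on a clique $K$ if $K$ is a maximal clique of both $S$ and $T$ and $V(S)\cap V(T)=V(K)$. If $S$ is a subgraph of $C_m$, the complete graph with vertices $v_1,\dots,v_m$, then $C_m\setminus S$ is the graph with vertices $v_1,\dots,v_m$ whose edges are those of $C_m$ that are not edges of $S$. $N_G(v)$ is the set of vertices adjacent to $v$ in $G$. Setting. Let $X_1,\dots,X_m\subseteq\mathbb R^n$ be open and bounded, let $\mu_i$ be a Borel probability measure on $X_i$, let $G$ be a graph with vertices $v_1,\dots,v_m$, and let $b(x_1,\dots,x_m)=\sum_{\{v_s,v_t\}\in E(G)}x_s\cdot x_t$. The Kantorovich problem is to maximize $\int b\,d\gamma$ among all Borel probability measures $\gamma$ on $X_1\times\dots\times X_m$ with marginals $\mu_1,\dots,\mu_m$. "Regular" means absolutely continuous with respect to Lebesgue measure on $\mathbb R^n$. Theorem. Let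 $\mu_1$ be regular, and assume that at least one of the following holds. (a) $G=C_m\setminus S$ is connected, where $S$ is a subgraph of $C_m$ with inner hub $A$, and either (i) $v_1\notin V(S)$, or (ii) there is $p$ such that $v_p\in N_G(v_1)$, $A\subseteq N_G(v_p)$ and $\mu_p$ is regular, and, if $S$ is not complete, $v_1\notin A$. (b) $G$ has an inner hub $A$, and $\mu_p$ is regular for some $p$ with $v_p\in A$. (c) There are a graph $S_1$ with inner hub $A_1$ and (pairwise different) maximal cliques $S_{11},\dots,S_{1l}$, a set $E\subseteq\{2,\dots,l\}$, and, for each $\alpha\in E$, a graph $S_\alpha$ with inner hub $A_\alpha\neq\emptyset$, such that $G=\bigcup_{\alpha\in E\cup\{1\}}S_\alpha$ and: $A_\alpha\cap A_1=\emptyset$ for $\alpha\in E$; $S_\alpha$ and $S_1$ are glued on a clique for $\alpha\in E$; $V(S_\alpha)\cap V(S_\beta)=A_1$ for different $\alpha,\beta\in E$; for each $\alpha\in E\cup\{1\}$ there is $p_\alpha$ with $v_{p_\alpha}\in A_\alpha$ and $\mu_{p_\alpha}$ regular; and $v_1\in V(S_{11})$. (d) $G=\bigcup_{\alpha=1}^lG_\alpha$,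 where $G_1,\dots,G_l$ are graphs with inner hubs $A_1,\dots,A_l$, $v_1\in V(G_1)$, and: for $\alpha\neq\beta$ one has $A_\alpha\cap A_\beta=\emptyset$, and either $V(G_\alpha)\cap V(G_\beta)=\emptyset$, or $G_\alpha$ and $G_\beta$ are glued on a clique, or $V(G_\alpha)\cap V(G_\beta)=A_\lambda$ for some $\lambda\notin\{\alpha,\beta\}$; for each $\alpha$ there is $p_\alpha$ with $v_{p_\alpha}\in A_\alpha$ and $\mu_{p_\alpha}$ regular; $v_1$ belongs to a maximal clique $K$ of $G_1$ such that no $G_\alpha$ with $\alpha\neq1$ is glued to $G_1$ on $K$; and the graph with vertices $1,\dots,l$ in which $\alpha\neq\beta$ are adjacent if $G_\alpha$ and $G_\beta$ are glued on a clique is a tree. Then the Kantorovich problem has exactly one solution. -/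

import Mathlib

namespace GraphOT

open MeasureTheory

/-! ### Graphs: maximal cliques, inner hubs, gluing -/

section Graphs

variable {V : Type*} {H : SimpleGraph V}

/-- `C` is the vertex set of a maximal complete subgraph of the graph `S`.  The graph `S` has its own
vertex set `S.verts`; a complete subgraph is determined by its vertices. -/
def IsMaximalClique (S : H.Subgraph) (C : Set V) : Prop :=
  Maximal (fun D : Set V => D ⊆ S.verts ∧ D.Pairwise S.Adj) C

/-- The graph `S` is complete. -/
def IsComplete (S : H.Subgraph) : Prop :=
  S.verts.Pairwise S.Adj

/-- `A` is the inner hub of the graph `S`: any two different maximal cliques of `S` meet exactly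
in `A`, and if `S` has only one maximal clique (that is, if `S` is complete) then `A` is the vertex
set of that clique. -/
def IsInnerHub (S : H.Subgraph) (A : Set V) : Prop :=
  (∀ C D : Set V, IsMaximalClique S C → IsMaximalClique S D → C ≠ D → C ∩ D = A) ∧
    ∀ C : Set V, IsMaximalClique S C → (∀ D : Set V, IsMaximalClique S D → D = C) → A = C

/-- `S` and `T` are glued on the clique `C`: it is a maximal clique of both, and it consists of
all their common vertices. -/
def GluedOn (S T : H.Subgraph) (C : Set V) : Prop :=
  IsMaximalClique S C ∧ IsMaximalClique T C ∧ S.verts ∩ T.verts = C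

/-- `S` and `T` are glued on a clique. -/
def Glued (S T : H.Subgraph) : Prop :=
  ∃ C : Set V, GluedOn S T C

theorem Glued.symm {S T : H.Subgraph} (h : Glued S T) : Glued T S := by
  obtain ⟨C, h1, h2, h3⟩ := h
  exact ⟨C, h2, h1, by rw [Set.inter_comm, h3]⟩

/-- The higher order graph of a family of graphs: its vertices are the members of the family, and
two different members are adjacent if they are glued on a clique. -/
def gluingGraph {ι : Type*} (S : ι → H.Subgraph) : SimpleGraph ι where
  Adj α β := α ≠ β ∧ Glued (S α) (S β)
  symm := ⟨fun _ _ h => ⟨h.1.symm, h.2.symm⟩⟩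
  loopless := ⟨fun _ h => h.1 rfl⟩

end Graphs

/-! ### The multi-marginal Kantorovich problem -/

section Kantorovich

variable {V : Type*} [Fintype V] {n : ℕ} {X : V → Set (EuclideanSpace ℝ (Fin n))}

open Classical in
/-- The surplus `b(x) = ∑ x_s ⬝ x_t`, the sum being over the edges `{v_s, v_t}` of `G`. -/
noncomputable def surplus (G : SimpleGraph V) (X : V → Set (EuclideanSpace ℝ (Fin n)))
    (x : (v : V) → X v) : ℝ :=
  ∑ e ∈ G.edgeFinset,
    Sym2.lift ⟨fun s t : V => inner ℝ (x s : EuclideanSpace ℝ (Fin n)) (x t),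
      fun _ _ => real_inner_comm _ _⟩ e

/-- `γ` is a Borel probability measure on the product of the `X v` with marginals `μ v`. -/
def IsTransportPlan (μ : (v : V) → Measure (X v)) (γ : Measure ((v : V) → X v)) : Prop :=
  IsProbabilityMeasure γ ∧ ∀ v : V, γ.map (fun x => x v) = μ v

/-- `γ` solves the Kantorovich problem: it maximizes the integral of the surplus associated to `G`
among all probability measures on the product with the given marginals. -/
def IsKantorovichSolution (G : SimpleGraph V) (μ : (v : V) → Measure (X v))
    (γ : Measure ((v : V) → X v)) : Prop :=
  IsTransportPlan μ γ ∧
    ∀ γ' : Measure ((v : V) → X v), IsTransportPlan μ γ' →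
      ∫ x, surplus G X x ∂γ' ≤ ∫ x, surplus G X x ∂γ

/-- A measure on `U ⊆ ℝⁿ` is absolutely continuous with respect to Lebesgue measure on `ℝⁿ`. -/
def IsAC {U : Set (EuclideanSpace ℝ (Fin n))} (ν : Measure U) : Prop :=
  ν.map ((↑) : U → EuclideanSpace ℝ (Fin n)) ≪ volume

/-! ### The four sets of hypotheses -/

/-- First case: `G` is connected and is obtained from the complete graph by extraction of a subgraph
`S` with inner hub `A`. -/
def ExtractionHypotheses (G : SimpleGraph V) (v₁ : V) (μ : (v : V) → Measure (X v)) : Prop :=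
  ∃ (S : (⊤ : SimpleGraph V).Subgraph) (A : Set V),
    IsInnerHub S A ∧
    G = (⊤ : SimpleGraph V) \ S.spanningCoe ∧
    G.Connected ∧
    IsAC (μ v₁) ∧
    (v₁ ∉ S.verts ∨
      ∃ p : V, G.Adj v₁ p ∧ A ⊆ G.neighborSet p ∧ IsAC (μ p) ∧ (¬ IsComplete S → v₁ ∉ A))

/-- Second case: `G` has an inner hub. -/
def InnerHubHypotheses (G : SimpleGraph V) (v₁ : V) (μ : (v : V) → Measure (X v)) : Prop :=
  ∃ A : Set V,
    IsInnerHub (⊤ : G.Subgraph) A ∧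
    IsAC (μ v₁) ∧
    ∃ p ∈ A, IsAC (μ p)

/-- Third case: graphs `S α`, `α ∈ E`, with inner hubs are glued on cliques to a central graph `S 0`
with inner hub `A 0` and maximal cliques `K 0, …, K l`, and `G` is the union of these graphs.
The indices are `0, …, l` instead of `1, …, l`. -/
def StarGluingHypotheses (G : SimpleGraph V) (v₁ : V) (μ : (v : V) → Measure (X v)) : Prop :=
  ∃ (l : ℕ) (K : Fin (l + 1) → Set V) (E : Set (Fin (l + 1)))
    (S : Fin (l + 1) → G.Subgraph) (A : Fin (l + 1) → Set V),
    Function.Injective K ∧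
    Set.range K = {C : Set V | IsMaximalClique (S 0) C} ∧
    0 ∉ E ∧
    (∀ α ∈ insert 0 E, IsInnerHub (S α) (A α)) ∧
    (∀ α ∈ E, (A α).Nonempty ∧ A α ∩ A 0 = ∅) ∧
    (⨆ α ∈ insert 0 E, S α) = ⊤ ∧
    (∀ α ∈ E, Glued (S α) (S 0)) ∧
    (∀ α ∈ E, ∀ β ∈ E, α ≠ β → (S α).verts ∩ (S β).verts = A 0) ∧
    (∀ α ∈ insert 0 E, ∃ p ∈ A α, IsAC (μ p)) ∧
    IsAC (μ v₁) ∧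
    v₁ ∈ K 0

/-- Fourth case: `G` is the union of graphs `S 0, …, S l` with inner hubs `A 0, …, A l`, glued on
cliques along a tree.  The indices are `0, …, l` instead of `1, …, l`. -/
def TreeGluingHypotheses (G : SimpleGraph V) (v₁ : V) (μ : (v : V) → Measure (X v)) : Prop :=
  ∃ (l : ℕ) (S : Fin (l + 1) → G.Subgraph) (A : Fin (l + 1) → Set V),
    (∀ α, IsInnerHub (S α) (A α)) ∧
    (⨆ α, S α) = ⊤ ∧
    v₁ ∈ (S 0).verts ∧
    (∀ α β, α ≠ β →
      A α ∩ A β = ∅ ∧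
      ((S α).verts ∩ (S β).verts = ∅ ∨
        Glued (S α) (S β) ∨
        ∃ δ, δ ≠ α ∧ δ ≠ β ∧ (S α).verts ∩ (S β).verts = A δ)) ∧
    IsAC (μ v₁) ∧
    (∀ α, ∃ p ∈ A α, IsAC (μ p)) ∧
    (∃ C : Set V, IsMaximalClique (S 0) C ∧ v₁ ∈ C ∧ ∀ α, α ≠ 0 → ¬ GluedOn (S 0) (S α) C) ∧
    (gluingGraph S).IsTree

end Kantorovich

end GraphOT

/-! Duality gives a plan together with Lipschitz potentials `u v` whose sum dominates the surplus
and has the same integral (`exists_plan_and_potentials`). Every solution therefore lives on the set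
where the sum of potentials equals the surplus. Where `μ v` is absolutely continuous, Rademacher's
theorem makes `u v` differentiable almost everywhere. If the projection to coordinate `v₁` is
injective on the resulting contact set, a plan concentrated there is determined by its `v₁`-marginal
(`eq_of_injOn_of_map_eq`), hence uniqueness.

For injectivity, take contact points `x`, `y` and `d = x - y`. Exchanging coordinates of `x` and `y`
across a cut `T` shows that the interaction of `d` across `T` is nonnegative, and that if it is zero
the exchanged points are again contact points, so that `d` truncated to `T` is again a difference of
contact points. Equality of gradients at a regular vertex where `d` vanishes gives total zero of `d`
over its neighbors. These three properties are `IsExchangeable`; what remains is the purely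
combinatorial claim that `d v₁ = 0` forces `d = 0`.

The lever is a cut whose crossing edges form a complete bipartite graph between `P` and `Q`: the
interaction is then the inner product of the totals over `P` and `Q`, so if these totals are
opposite, both vanish (`IsExchangeable.total_left_eq_zero`). Inner hubs supply such cuts: the hub,
each petal (a maximal clique minus the hub), and the part of a tree gluing that hangs on a petal.
The extraction case is `eq_zero_of_extraction`; the other three are tree gluings, with trees a
point, a star and the given tree (`IsTreeGluing.eq_zero`). -/

namespace GraphOT

open MeasureTheory

/-! ### Kantorovich duality on a compact space -/

section Duality

variable {V Y : Type*} [Fintype V] [MetricSpace Y] [CompactSpace Y] [MeasurableSpace Y]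

/-- The values of the dual problem: the sums `∑ ∫ u v` over all families `u` of continuous
potentials such that `f x ≤ ∑ u v (x v)`. -/
def dualValues (ν : V → Measure Y) (f : C(V → Y, ℝ)) : Set ℝ :=
  {r | ∃ u : V → C(Y, ℝ), (∀ x, f x ≤ ∑ v, u v (x v)) ∧ ∑ v, ∫ y, u v y ∂ν v = r}

/-- The infimum of the dual problem. -/
noncomputable def dualValue (ν : V → Measure Y) (f : C(V → Y, ℝ)) : ℝ :=
  sInf (dualValues ν f)

theorem dualValues_nonempty [Nonempty V] (ν : V → Measure Y) (f : C(V → Y, ℝ)) :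
    (dualValues ν f).Nonempty := by
  classical
  obtain ⟨v₀⟩ := ‹Nonempty V›
  refine ⟨_, fun v => if v = v₀ then ContinuousMap.const Y ‖f‖ else 0, fun x => ?_, rfl⟩
  have : ∑ v, (if v = v₀ then ContinuousMap.const Y ‖f‖ else 0 : C(Y, ℝ)) (x v) = ‖f‖ := by
    rw [Finset.sum_eq_single v₀] <;> simp +contextual
  rw [this]
  exact f.apply_le_norm x

theorem exists_sum_integral_lt [Nonempty V] {ν : V → Measure Y} (f : C(V → Y, ℝ)) {r : ℝ}
    (hr : dualValue ν f < r) :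
    ∃ u : V → C(Y, ℝ), (∀ x, f x ≤ ∑ v, u v (x v)) ∧ ∑ v, ∫ y, u v y ∂ν v < r := by
  obtain ⟨_, ⟨u, hu, rfl⟩, h⟩ := exists_lt_of_csInf_lt (dualValues_nonempty ν f) hr
  exact ⟨u, hu, h⟩

variable [BorelSpace Y] {ν : V → Measure Y} [∀ v, IsProbabilityMeasure (ν v)]

theorem integrable_continuousMap {Z : Type*} [TopologicalSpace Z] [CompactSpace Z]
    [MeasurableSpace Z] [OpensMeasurableSpace Z]
    [SecondCountableTopologyEither Z ℝ] (ρ : Measure Z) [IsFiniteMeasure ρ] (g : C(Z, ℝ)) :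
    Integrable (fun z => g z) ρ :=
  (BoundedContinuousFunction.mkOfCompact g).integrable ρ

theorem le_sum_integral_of_forall_le {u : V → C(Y, ℝ)} {m : ℝ}
    (h : ∀ x : V → Y, m ≤ ∑ v, u v (x v)) : m ≤ ∑ v, ∫ y, u v y ∂ν v := by
  have hmin : ∀ v, ∃ y, ∀ z, u v y ≤ u v z := fun v => by
    obtain ⟨y₀⟩ : Nonempty Y := (ν v).nonempty_of_neZero
    obtain ⟨y, -, hy⟩ := isCompact_univ.exists_isMinOn ⟨y₀, trivial⟩ (u v).continuous.continuousOn
    exact ⟨y, fun z => hy (Set.mem_univ z)⟩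
  choose y hy using hmin
  refine (h y).trans (Finset.sum_le_sum fun v _ => ?_)
  have := integral_mono (μ := ν v) (integrable_const (u v (y v))) (integrable_continuousMap _ (u v))
    (hy v)
  simpa using this

theorem bddBelow_dualValues (f : C(V → Y, ℝ)) : BddBelow (dualValues ν f) := by
  refine ⟨-‖f‖, ?_⟩
  rintro _ ⟨u, hu, rfl⟩
  exact le_sum_integral_of_forall_le fun x => (f.neg_norm_le_apply x).trans (hu x)

theorem dualValue_le {f : C(V → Y, ℝ)} {u : V → C(Y, ℝ)} (hu : ∀ x, f x ≤ ∑ v, u v (x v)) :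
    dualValue ν f ≤ ∑ v, ∫ y, u v y ∂ν v :=
  csInf_le (bddBelow_dualValues f) ⟨u, hu, rfl⟩

theorem dualValue_add_le [Nonempty V] (f g : C(V → Y, ℝ)) :
    dualValue ν (f + g) ≤ dualValue ν f + dualValue ν g := by
  refine le_of_forall_pos_le_add fun ε hε => ?_
  obtain ⟨u, hu, hu'⟩ := exists_sum_integral_lt (ν := ν) f (lt_add_of_pos_right _ (half_pos hε))
  obtain ⟨w, hw, hw'⟩ := exists_sum_integral_lt (ν := ν) g (lt_add_of_pos_right _ (half_pos hε))
  have h := dualValue_le (ν := ν) (f := f + g) (u := fun v => u v + w v) fun x => by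
    simpa [Finset.sum_add_distrib] using add_le_add (hu x) (hw x)
  have h2 : ∑ v, ∫ y, (u v + w v) y ∂ν v = ∑ v, ∫ y, u v y ∂ν v + ∑ v, ∫ y, w v y ∂ν v := by
    rw [← Finset.sum_add_distrib]
    exact Finset.sum_congr rfl fun v _ =>
      integral_add (integrable_continuousMap _ (u v)) (integrable_continuousMap _ (w v))
  rw [h2] at h
  linarith

theorem dualValue_smul_le [Nonempty V] (f : C(V → Y, ℝ)) {c : ℝ} (hc : 0 < c) :
    dualValue ν (c • f) ≤ c * dualValue ν f := by
  refine le_of_forall_pos_le_add fun ε hε => ?_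
  obtain ⟨u, hu, hu'⟩ := exists_sum_integral_lt (ν := ν) f
    (lt_add_of_pos_right _ (div_pos hε hc))
  have h := dualValue_le (ν := ν) (f := c • f) (u := fun v => c • u v) fun x => by
    simpa [Finset.mul_sum] using mul_le_mul_of_nonneg_left (hu x) hc.le
  have h2 : ∑ v, ∫ y, (c • u v) y ∂ν v = c * ∑ v, ∫ y, u v y ∂ν v := by
    rw [Finset.mul_sum]
    exact Finset.sum_congr rfl fun v _ => integral_const_mul _ _
  rw [h2] at h
  have h3 := mul_lt_mul_of_pos_left hu' hc
  rw [mul_add, mul_div_cancel₀ _ hc.ne'] at h3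
  linarith

theorem dualValue_smul [Nonempty V] (f : C(V → Y, ℝ)) {c : ℝ} (hc : 0 < c) :
    dualValue ν (c • f) = c * dualValue ν f := by
  refine (dualValue_smul_le f hc).antisymm ?_
  have h := dualValue_smul_le (ν := ν) (c • f) (inv_pos.2 hc)
  rw [inv_smul_smul₀ hc.ne'] at h
  calc c * dualValue ν f ≤ c * (c⁻¹ * dualValue ν (c • f)) := mul_le_mul_of_nonneg_left h hc.le
    _ = dualValue ν (c • f) := by rw [mul_inv_cancel_left₀ hc.ne']

/-- Hahn–Banach: the dual value is sublinear in `f`, so the functional `c • f ↦ c * dualValue ν f`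
on the line through `f` extends below it. -/
theorem exists_linearMap_le_dualValue [Nonempty V] (f : C(V → Y, ℝ)) :
    ∃ L : C(V → Y, ℝ) →ₗ[ℝ] ℝ, L f = dualValue ν f ∧ ∀ g, L g ≤ dualValue ν g := by
  have h0 : dualValue ν (0 : C(V → Y, ℝ)) = 0 := by
    have := dualValue_smul (ν := ν) (0 : C(V → Y, ℝ)) two_pos
    rw [smul_zero] at this
    linarith
  have H : ∀ c : ℝ, c • f = 0 → (RingHom.id ℝ) c • dualValue ν f = 0 := fun c hc => by
    rcases smul_eq_zero.1 hc with rfl | rfl <;> simp [h0]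
  obtain ⟨L, hL, hL'⟩ := exists_extension_of_le_sublinear
    (LinearPMap.mkSpanSingleton' f (dualValue ν f) H) (dualValue ν)
    (fun c hc g => dualValue_smul g hc) dualValue_add_le (by
      rintro ⟨g, hg⟩
      obtain ⟨c, rfl⟩ := Submodule.mem_span_singleton.1 hg
      rw [LinearPMap.mkSpanSingleton'_apply]
      change c * dualValue ν f ≤ dualValue ν (c • f)
      rcases lt_trichotomy c 0 with hc | rfl | hc
      · have h1 := dualValue_smul (ν := ν) f (neg_pos.2 hc)
        have h2 := dualValue_add_le (ν := ν) (c • f) (-c • f)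
        rw [← add_smul, add_neg_cancel, zero_smul, h0, h1] at h2
        linarith
      · simp [h0]
      · exact (dualValue_smul f hc).ge)
  refine ⟨L, ?_, hL'⟩
  rw [hL ⟨f, Submodule.mem_span_singleton_self f⟩]
  exact LinearPMap.mkSpanSingleton'_apply_self _ _ _ _

/-- Kantorovich duality on a compact space: some plan attains the value of the dual problem. -/
theorem exists_plan_integral_eq_dualValue [Nonempty V] (f : C(V → Y, ℝ)) :
    ∃ γ : Measure (V → Y), IsProbabilityMeasure γ ∧ (∀ v, γ.map (fun x => x v) = ν v) ∧
      ∫ x, f x ∂γ = dualValue ν f := by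
  classical
  obtain ⟨L, hLf, hL⟩ := exists_linearMap_le_dualValue (ν := ν) f
  -- The zero potentials dominate `-g`, so `L (-g) ≤ 0`.
  have hpos : ∀ g : C(V → Y, ℝ), (∀ x, 0 ≤ g x) → 0 ≤ L g := fun g hg => by
    have h1 := (hL (-g)).trans (dualValue_le (u := 0) fun x => by simpa using hg x)
    simpa using h1
  -- A function of the coordinate `v` alone is its own potential; applying the bound to `g` and `-g`
  -- gives equality. This fixes the marginals of the Riesz measure of `L`.
  have hsingle : ∀ (v : V) (g : C(Y, ℝ)),
      L (g.comp (ContinuousMap.eval v)) = ∫ y, g y ∂ν v := fun v g => by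
    have key : ∀ g : C(Y, ℝ), L (g.comp (ContinuousMap.eval v)) ≤ ∫ y, g y ∂ν v := fun g => by
      refine (hL _).trans ((dualValue_le (u := Pi.single v g) fun x => ?_).trans_eq ?_)
      · rw [Finset.sum_eq_single v] <;> simp +contextual
      · rw [Finset.sum_eq_single v] <;> simp +contextual
    refine (key g).antisymm ?_
    have h2 := key (-g)
    have h3 : (-g).comp (ContinuousMap.eval v) =
        -g.comp (ContinuousMap.eval (X := fun _ => Y) v) := rfl
    rw [h3, map_neg] at h2
    simp only [ContinuousMap.neg_apply, integral_neg] at h2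
    linarith
  let L' : CompactlySupportedContinuousMap (V → Y) ℝ →ₗ[ℝ] ℝ :=
    { toFun := fun g => L (g : C(V → Y, ℝ))
      map_add' := fun g h => map_add L (g : C(V → Y, ℝ)) h
      map_smul' := fun c g => map_smul L c (g : C(V → Y, ℝ)) }
  let Λ : CompactlySupportedContinuousMap (V → Y) ℝ →ₚ[ℝ] ℝ :=
    PositiveLinearMap.mk₀ L' fun g hg => hpos _ fun x => hg x
  let γ := RealRMK.rieszMeasure Λ
  have hint : ∀ g : C(V → Y, ℝ), ∫ x, g x ∂γ = L g := fun g =>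
    RealRMK.integral_rieszMeasure Λ (CompactlySupportedContinuousMap.continuousMapEquiv g)
  have hfin : IsFiniteMeasure γ := inferInstance
  have hprob : IsProbabilityMeasure γ := by
    obtain ⟨v⟩ := ‹Nonempty V›
    have h1 := hint ((1 : C(Y, ℝ)).comp (ContinuousMap.eval v))
    rw [hsingle] at h1
    simp only [ContinuousMap.comp_apply, ContinuousMap.one_apply, integral_const, smul_eq_mul,
      mul_one, probReal_univ] at h1
    exact ⟨by rwa [measureReal_def, ENNReal.toReal_eq_one_iff] at h1⟩
  refine ⟨γ, hprob, fun v => ?_, by rw [hint, hLf]⟩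
  have hm : Measurable fun x : V → Y => x v := measurable_pi_apply v
  have := Measure.isProbabilityMeasure_map (μ := γ) hm.aemeasurable
  refine ext_of_forall_integral_eq_of_IsFiniteMeasure fun g => ?_
  rw [integral_map hm.aemeasurable g.continuous.aestronglyMeasurable]
  have := hint (g.toContinuousMap.comp (ContinuousMap.eval v))
  rw [hsingle] at this
  exact this

end Duality

/-! ### Existence of Lipschitz optimal potentials -/

section LipschitzDuality

open scoped NNReal

variable {V Y : Type*} [Fintype V] [MetricSpace Y]

theorem isCompact_setOf_lipschitzWith (C : ℝ≥0) (y₀ : Y) (M : ℝ) :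
    IsCompact {g : C(Y, ℝ) | LipschitzWith C g ∧ |g y₀| ≤ M} := by
  refine ArzelaAscoli.isCompact_of_equicontinuous _ ?_ ?_
  · have himg : ContinuousMap.toFun '' {g : C(Y, ℝ) | LipschitzWith C g ∧ |g y₀| ≤ M} =
        {g : Y → ℝ | LipschitzWith C g ∧ |g y₀| ≤ M} := by
      ext g
      constructor
      · rintro ⟨g, hg, rfl⟩
        exact hg
      · exact fun hg => ⟨⟨g, hg.1.continuous⟩, hg, rfl⟩
    rw [himg]
    refine (isCompact_univ_pi fun y => isCompact_Icc
      (a := -(M + C * dist y y₀)) (b := M + C * dist y y₀)).of_isClosed_subset ?_ ?_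
    · have : {g : Y → ℝ | LipschitzWith C g ∧ |g y₀| ≤ M} =
          (⋂ (x : Y) (y : Y), {g | g x ≤ g y + C * dist x y}) ∩ {g | |g y₀| ≤ M} := by
        ext g
        simp only [Set.mem_inter_iff, Set.mem_iInter, Set.mem_ofPred_eq]
        exact and_congr_left fun _ => ⟨fun h x y => h.le_add_mul x y, LipschitzWith.of_le_add_mul C⟩
      rw [this]
      refine (isClosed_iInter fun x => isClosed_iInter fun y => ?_).inter ?_
      · exact isClosed_le (continuous_apply x) ((continuous_apply y).add continuous_const)
      · exact isClosed_le (continuous_apply y₀).abs continuous_const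
    · rintro g ⟨hg, hM⟩ y -
      have h1 := hg.le_add_mul y y₀
      have h2 := hg.le_add_mul y₀ y
      rw [dist_comm] at h2
      have h3 := abs_le.1 hM
      constructor <;> linarith
  · refine Metric.equicontinuous_of_continuity_modulus (fun t => C * t) ?_ _ ?_
    · simpa using ((continuous_const_mul (C : ℝ)).tendsto 0)
    · rintro x y ⟨g, hg⟩
      exact hg.1.dist_le_mul x y

variable [CompactSpace Y]

/-- This is the infimal convolution of `g` with `C * dist`, attained by compactness. -/
theorem exists_lipschitz_minorant (C : ℝ≥0) (g : C(Y, ℝ)) :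
    ∃ h : C(Y, ℝ), LipschitzWith C h ∧ (∀ z, h z ≤ g z) ∧ ∀ z, ∃ w, g w + C * dist z w = h z := by
  have hmin : ∀ z : Y, ∃ w, ∀ w', g w + C * dist z w ≤ g w' + C * dist z w' := fun z => by
    obtain ⟨w, -, hw⟩ := isCompact_univ.exists_isMinOn ⟨z, trivial⟩
      (f := fun w => g w + C * dist z w) (by fun_prop)
    exact ⟨w, fun w' => hw (Set.mem_univ w')⟩
  choose w hw using hmin
  have hL : LipschitzWith C fun z => g (w z) + C * dist z (w z) := by
    refine LipschitzWith.of_le_add_mul C fun z z' => (hw z (w z')).trans ?_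
    rw [add_assoc, ← mul_add, add_comm (dist z' _)]
    gcongr
    exact dist_triangle _ _ _
  exact ⟨⟨_, hL.continuous⟩, hL, fun z => by simpa using hw z z, fun z => ⟨w z, rfl⟩⟩

/-- Infimal convolution lowers the potentials, yet the constraint survives because `f` itself varies
by at most `C` times the summed distances. -/
theorem exists_lipschitz_potentials {f : C(V → Y, ℝ)} {C : ℝ≥0}
    (hf : ∀ x y, f x ≤ f y + C * ∑ v, dist (x v) (y v)) {u : V → C(Y, ℝ)}
    (hu : ∀ x, f x ≤ ∑ v, u v (x v)) :
    ∃ w : V → C(Y, ℝ), (∀ v, LipschitzWith C (w v)) ∧ (∀ v z, w v z ≤ u v z) ∧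
      ∀ x, f x ≤ ∑ v, w v (x v) := by
  choose w hw hwu hatt using fun v => exists_lipschitz_minorant C (u v)
  refine ⟨w, hw, hwu, fun x => ?_⟩
  choose y hy using fun v => hatt v (x v)
  calc f x ≤ f y + C * ∑ v, dist (x v) (y v) := hf x y
    _ ≤ ∑ v, u v (y v) + C * ∑ v, dist (x v) (y v) := by gcongr; exact hu y
    _ = ∑ v, w v (x v) := by
      rw [Finset.mul_sum, ← Finset.sum_add_distrib]
      exact Finset.sum_congr rfl fun v _ => hy v

variable [MeasurableSpace Y] [BorelSpace Y] {ν : V → Measure Y} [∀ v, IsProbabilityMeasure (ν v)]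

theorem continuous_sum_integral (ν : V → Measure Y) [∀ v, IsProbabilityMeasure (ν v)] :
    Continuous fun u : V → C(Y, ℝ) => ∑ v, ∫ y, u v y ∂ν v := by
  refine continuous_finsetSum _ fun v _ => ?_
  have : LipschitzWith 1 fun g : C(Y, ℝ) => ∫ y, g y ∂ν v := by
    refine LipschitzWith.of_dist_le_mul fun g h => ?_
    rw [Real.dist_eq, ← integral_sub (integrable_continuousMap _ g) (integrable_continuousMap _ h)]
    have := norm_integral_le_of_norm_le_const (μ := ν v) (f := fun y => g y - h y) (C := dist g h)
      (Filter.Eventually.of_forall fun y => by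
        rw [← dist_eq_norm]
        exact ContinuousMap.dist_apply_le_dist y)
    simpa using this
  exact this.continuous.comp (continuous_apply v)

/-- The dual problem for a Lipschitz function has a Lipschitz solution. -/
theorem exists_lipschitz_dual_solution [Nonempty V] {f : C(V → Y, ℝ)} {C : ℝ≥0}
    (hf : ∀ x y, f x ≤ f y + C * ∑ v, dist (x v) (y v)) :
    ∃ u : V → C(Y, ℝ), (∀ v, LipschitzWith C (u v)) ∧ (∀ x, f x ≤ ∑ v, u v (x v)) ∧
      ∑ v, ∫ y, u v y ∂ν v = dualValue ν f := by
  classical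
  obtain ⟨v₀⟩ := ‹Nonempty V›
  have : Nonempty V := ⟨v₀⟩
  obtain ⟨y₀⟩ : Nonempty Y := (ν v₀).nonempty_of_neZero
  -- `B` bounds the total oscillation of `C`-Lipschitz potentials. For nearly optimal ones, `M` then
  -- bounds the sum of their values at `y₀`: from below by the constraint, from above by the
  -- objective.
  set B : ℝ := Fintype.card V * (C * Metric.diam (Set.univ : Set Y)) with hB
  have hB0 : 0 ≤ B := by positivity
  set M : ℝ := |f fun _ => y₀| + |dualValue ν f + 1| + B with hM
  let F : Set (V → C(Y, ℝ)) := {u | ∀ x, f x ≤ ∑ v, u v (x v)}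
  let S : Set (V → C(Y, ℝ)) := Set.univ.pi fun _ => {g | LipschitzWith C g ∧ |g y₀| ≤ M}
  have hS : IsCompact S := isCompact_univ_pi fun _ => isCompact_setOf_lipschitzWith C y₀ M
  have hF : IsClosed F := by
    have : F = ⋂ x : V → Y, {u | f x ≤ ∑ v, u v (x v)} := by ext; simp [F]
    rw [this]
    refine isClosed_iInter fun x => isClosed_le continuous_const
      (continuous_finsetSum _ fun v _ => ?_)
    exact (continuous_eval_const (x v)).comp (continuous_apply v)
  have key : ∀ r, dualValue ν f < r → r ≤ dualValue ν f + 1 →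
      ∃ u ∈ S ∩ F, ∑ v, ∫ y, u v y ∂ν v < r := by
    intro r hr hr1
    obtain ⟨u', hu', hJ'⟩ := exists_sum_integral_lt f hr
    obtain ⟨u, huL, huu', hu⟩ := exists_lipschitz_potentials hf hu'
    have hJ : ∑ v, ∫ y, u v y ∂ν v < r := (Finset.sum_le_sum fun v _ =>
      integral_mono (integrable_continuousMap _ (u v)) (integrable_continuousMap _ (u' v))
        (huu' v)).trans_lt hJ'
    set s := ∑ v, u v y₀ with hs
    have hs1 : f (fun _ => y₀) ≤ s := hu fun _ => y₀
    have hs2 : s - B ≤ r := by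
      refine (le_sum_integral_of_forall_le (ν := ν) (u := u) fun x => ?_).trans hJ.le
      have : ∀ v, u v y₀ ≤ u v (x v) + C * Metric.diam (Set.univ : Set Y) := fun v =>
        ((huL v).le_add_mul y₀ (x v)).trans (by
          gcongr
          exact Metric.dist_le_diam_of_mem isCompact_univ.isBounded trivial trivial)
      have h2 := Finset.sum_le_sum fun v (_ : v ∈ Finset.univ) => this v
      rw [Finset.sum_add_distrib, Finset.sum_const, Finset.card_univ, nsmul_eq_mul] at h2
      linarith
    have hsM : |s| ≤ M := by
      rw [abs_le]
      have h1 := neg_abs_le (f fun _ => y₀)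
      have h2 := le_abs_self (dualValue ν f + 1)
      have h3 := abs_nonneg (f fun _ => y₀)
      have h4 := abs_nonneg (dualValue ν f + 1)
      constructor <;> linarith
    -- Constants of total zero change neither the constraint nor the objective. These move all the
    -- mass of the values at `y₀` onto `v₀`, which puts the family in the compact set `S`.
    let c : V → ℝ := fun v => (if v = v₀ then s else 0) - u v y₀
    have hc : ∑ v, c v = 0 := by simp [c, hs]
    refine ⟨fun v => u v + ContinuousMap.const Y (c v), ⟨fun v _ => ⟨?_, ?_⟩, fun x => ?_⟩, ?_⟩
    · refine LipschitzWith.of_le_add_mul C fun x y => ?_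
      have := (huL v).le_add_mul x y
      simp only [ContinuousMap.add_apply, ContinuousMap.const_apply]
      linarith
    · simp only [ContinuousMap.add_apply, ContinuousMap.const_apply, c]
      split_ifs
      · simpa using hsM
      · simpa using (abs_nonneg s).trans hsM
    · simpa [Finset.sum_add_distrib, hc] using hu x
    · refine lt_of_eq_of_lt ?_ hJ
      have : ∀ v, ∫ y, (u v + ContinuousMap.const Y (c v)) y ∂ν v = ∫ y, u v y ∂ν v + c v :=
        fun v => by
          simp only [ContinuousMap.add_apply, ContinuousMap.const_apply]
          rw [integral_add (integrable_continuousMap _ (u v)) (integrable_const _)]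
          simp
      simp only [this]
      rw [Finset.sum_add_distrib, hc, add_zero]
  obtain ⟨u₁, hu₁, -⟩ := key _ (lt_add_one _) le_rfl
  obtain ⟨u, ⟨huS, huF⟩, hmin⟩ := (hS.inter_right hF).exists_isMinOn ⟨u₁, hu₁⟩
    (continuous_sum_integral ν).continuousOn
  refine ⟨u, fun v => (huS v trivial).1, huF, le_antisymm ?_ (dualValue_le huF)⟩
  refine le_of_forall_pos_le_add fun ε hε => ?_
  obtain ⟨w, hw, hJ⟩ := key (dualValue ν f + min ε 1) (by simp [hε]) (by simp)
  exact (hmin hw).trans (hJ.le.trans (by gcongr; exact min_le_left _ _))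

end LipschitzDuality

/-! ### The surplus as a quadratic form -/

section Pairing

variable {V : Type*} [Fintype V] {E : Type*} [NormedAddCommGroup E] [InnerProductSpace ℝ E]

open Classical in
/-- The bilinear form `∑ x s ⬝ y t`, the sum being over the pairs `(s, t)` of adjacent vertices. -/
noncomputable def pairing (G : SimpleGraph V) (x y : V → E) : ℝ :=
  ∑ s, ∑ t, if G.Adj s t then inner ℝ (x s) (y t) else 0

open Classical in
theorem two_mul_sum_edgeFinset (G : SimpleGraph V) (g : Sym2 V → ℝ) :
    2 * ∑ e ∈ G.edgeFinset, g e = ∑ s, ∑ t, if G.Adj s t then g s(s, t) else 0 := by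
  rw [← Finset.sum_product', ← Finset.sum_filter, Finset.mul_sum]
  rw [← Finset.sum_fiberwise_of_maps_to (t := G.edgeFinset) (g := fun p : V × V => s(p.1, p.2))
    (fun p hp => by simpa using hp)]
  refine Finset.sum_congr rfl fun e he => ?_
  induction e using Sym2.ind with
  | _ a b =>
    have hab : G.Adj a b := by simpa using he
    have : ((Finset.univ ×ˢ Finset.univ).filter fun p : V × V => G.Adj p.1 p.2).filter
        (fun p => s(p.1, p.2) = s(a, b)) = {(a, b), (b, a)} := by
      ext ⟨s, t⟩
      simp only [Finset.mem_filter, Finset.mem_product, Finset.mem_univ, true_and, Sym2.eq_iff,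
        Finset.mem_insert, Finset.mem_singleton, Prod.mk.injEq, and_iff_right_iff_imp]
      rintro (⟨rfl, rfl⟩ | ⟨rfl, rfl⟩)
      · exact hab
      · exact hab.symm
    rw [this, Finset.sum_pair (by simp [hab.ne]), Sym2.eq_swap (a := b), two_mul]

theorem continuous_pairing_self (G : SimpleGraph V) :
    Continuous fun x : V → E => pairing G x x := by
  unfold pairing
  refine continuous_finsetSum _ fun s _ => continuous_finsetSum _ fun t _ => ?_
  split_ifs <;> fun_prop

theorem pairing_self_sub_le (G : SimpleGraph V) {R : ℝ} {x y : V → E}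
    (hx : ∀ v, ‖x v‖ ≤ R) (hy : ∀ v, ‖y v‖ ≤ R) :
    pairing G x x - pairing G y y ≤ 2 * (R * Fintype.card V) * ∑ v, dist (x v) (y v) := by
  classical
  have key : ∀ s t, (if G.Adj s t then inner ℝ (x s) (x t) else 0) -
      (if G.Adj s t then inner ℝ (y s) (y t) else 0) ≤
      R * dist (x s) (y s) + R * dist (x t) (y t) := fun s t => by
    have hR : 0 ≤ R := (norm_nonneg _).trans (hx s)
    split_ifs
    · have h1 : inner ℝ (x s) (x t) - inner ℝ (y s) (y t) =
          inner ℝ (x s - y s) (x t) + inner ℝ (y s) (x t - y t) := by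
        rw [inner_sub_left, inner_sub_right]; ring
      rw [h1, dist_eq_norm, dist_eq_norm]
      refine add_le_add ((real_inner_le_norm _ _).trans ?_) ((real_inner_le_norm _ _).trans ?_)
      · rw [mul_comm]
        exact mul_le_mul_of_nonneg_right (hx t) (norm_nonneg _)
      · exact mul_le_mul_of_nonneg_right (hy s) (norm_nonneg _)
    · rw [sub_zero]; positivity
  calc pairing G x x - pairing G y y
      ≤ ∑ s, ∑ t, (R * dist (x s) (y s) + R * dist (x t) (y t)) := by
        simp only [pairing, ← Finset.sum_sub_distrib]
        exact Finset.sum_le_sum fun s _ => Finset.sum_le_sum fun t _ => key s t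
    _ = 2 * (R * Fintype.card V) * ∑ v, dist (x v) (y v) := by
        simp only [Finset.sum_add_distrib, Finset.sum_const, Finset.card_univ, nsmul_eq_mul,
          ← Finset.mul_sum]
        ring

end Pairing

/-! ### Passing from a closed ball to the open sets `X v` -/

section Transfer

open scoped NNReal

variable {V : Type*} [Fintype V] {n : ℕ} {X : V → Set (EuclideanSpace ℝ (Fin n))}

theorem surplus_eq_pairing (G : SimpleGraph V) (x : (v : V) → X v) :
    surplus G X x = pairing G (fun v => (x v : EuclideanSpace ℝ (Fin n))) (fun v => x v) / 2 := by
  classical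
  rw [eq_div_iff two_ne_zero, mul_comm, surplus, pairing]
  convert two_mul_sum_edgeFinset G (Sym2.lift ⟨fun s t : V =>
    inner ℝ (x s : EuclideanSpace ℝ (Fin n)) (x t), fun _ _ => real_inner_comm _ _⟩) using 1
  simp only [Sym2.lift_mk]

theorem continuous_surplus (G : SimpleGraph V) : Continuous (surplus G X) := by
  have : surplus G X = fun x => pairing G (fun v => (x v : EuclideanSpace ℝ (Fin n)))
      (fun v => x v) / 2 := funext (surplus_eq_pairing G)
  rw [this]
  exact ((continuous_pairing_self G).comp
    (continuous_pi fun v => continuous_subtype_val.comp (continuous_apply v))).div_const 2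

/-- The Kantorovich problem has a plan and Lipschitz potentials which certify each other's
optimality. -/
theorem exists_plan_and_potentials [Nonempty V]
    (hXo : ∀ v, IsOpen (X v)) (hXb : ∀ v, Bornology.IsBounded (X v))
    (μ : (v : V) → Measure (X v)) (hμ : ∀ v, IsProbabilityMeasure (μ v)) (G : SimpleGraph V) :
    ∃ (γ : Measure ((v : V) → X v)) (C : ℝ≥0) (u : V → EuclideanSpace ℝ (Fin n) → ℝ),
      IsTransportPlan μ γ ∧ (∀ v, LipschitzWith C (u v)) ∧
      (∀ x, surplus G X x ≤ ∑ v, u v (x v)) ∧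
      ∫ x, surplus G X x ∂γ = ∑ v, ∫ y, u v y ∂μ v := by
  classical
  obtain ⟨R, hR⟩ : ∃ R : ℝ, ∀ v, X v ⊆ Metric.closedBall 0 R := by
    obtain ⟨R, hR⟩ := ((Bornology.isBounded_iUnion).2 hXb).subset_closedBall 0
    exact ⟨R, fun v => (Set.subset_iUnion X v).trans hR⟩
  let Y := Metric.closedBall (0 : EuclideanSpace ℝ (Fin n)) R
  have : CompactSpace Y := isCompact_iff_compactSpace.1 (isCompact_closedBall _ _)
  let j : (v : V) → X v → Y := fun v => Set.inclusion (hR v)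
  have hj : ∀ v, MeasurableEmbedding (j v) := fun v => by
    have := (hXo v).polishSpace
    exact (continuous_inclusion (hR v)).measurableEmbedding (Set.inclusion_injective (hR v))
  let Φ : ((v : V) → X v) → V → Y := fun x v => j v (x v)
  have hΦ : MeasurableEmbedding Φ := by
    have := fun v => (hXo v).polishSpace
    exact (continuous_pi fun v => (continuous_inclusion (hR v)).comp
      (continuous_apply v)).measurableEmbedding
      fun x y h => funext fun v => Set.inclusion_injective (hR v) (congrFun h v)
  let ν : V → Measure Y := fun v => (μ v).map (j v)
  have hν : ∀ v, IsProbabilityMeasure (ν v) := fun v =>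
    Measure.isProbabilityMeasure_map (hj v).measurable.aemeasurable
  let f : C(V → Y, ℝ) := ⟨fun x => pairing G (fun v => (x v : EuclideanSpace ℝ (Fin n)))
    (fun v => x v) / 2, ((continuous_pairing_self G).comp
      (continuous_pi fun v => continuous_subtype_val.comp (continuous_apply v))).div_const 2⟩
  have hfΦ : ∀ x, f (Φ x) = surplus G X x := fun x => (surplus_eq_pairing G x).symm
  have hball : ∀ y : Y, ‖(y : EuclideanSpace ℝ (Fin n))‖ ≤ R := fun y =>
    mem_closedBall_zero_iff.1 y.2
  -- Half the constant of `pairing_self_sub_le`, as the surplus is half the pairing.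
  let C : ℝ≥0 := Real.toNNReal (R * Fintype.card V)
  have hf : ∀ x y, f x ≤ f y + C * ∑ v, dist (x v) (y v) := fun x y => by
    have h1 := pairing_self_sub_le G (fun v => hball (x v)) (fun v => hball (y v))
    have h2 : R * Fintype.card V * ∑ v, dist (x v) (y v) ≤ C * ∑ v, dist (x v) (y v) :=
      mul_le_mul_of_nonneg_right (Real.le_coe_toNNReal _)
        (Finset.sum_nonneg fun v _ => dist_nonneg)
    simp only [Subtype.dist_eq] at h2 ⊢
    simp only [f, ContinuousMap.coe_mk]
    linarith
  obtain ⟨γ', hγ', hmarg, hval⟩ := exists_plan_integral_eq_dualValue (ν := ν) f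
  obtain ⟨u', hu'L, hu', hJ⟩ := exists_lipschitz_dual_solution (ν := ν) hf
  have hext : ∀ v, ∃ w : EuclideanSpace ℝ (Fin n) → ℝ, LipschitzWith C w ∧
      ∀ y : Y, w y = u' v y := fun v => by
    let w₀ : EuclideanSpace ℝ (Fin n) → ℝ := fun z => if h : z ∈ Y then u' v ⟨z, h⟩ else 0
    have hw₀ : ∀ y : Y, w₀ y = u' v y := fun y => by simp [w₀]
    have hL : LipschitzOnWith C w₀ Y := by
      rw [lipschitzOnWith_iff_restrict]
      have : Set.domRestrict Y w₀ = u' v := funext hw₀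
      rw [this]
      exact hu'L v
    obtain ⟨w, hw, hww⟩ := hL.extend_real
    exact ⟨w, hw, fun y => (hww y.2).symm.trans (hw₀ y)⟩
  choose u hu huu' using hext
  -- Each marginal is carried by the image of `X v`, so the plan is carried by the image of the
  -- product and can be pulled back.
  have hrange : ∀ᵐ x ∂γ', x ∈ Set.range Φ := by
    have h1 : ∀ v, ∀ᵐ x ∂γ', x v ∈ Set.range (j v) := fun v => by
      have h2 : ∀ᵐ y ∂ν v, y ∈ Set.range (j v) :=
        (ae_map_iff (hj v).measurable.aemeasurable (hj v).measurableSet_range).2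
          (Filter.Eventually.of_forall fun x => Set.mem_range_self x)
      rw [← hmarg v] at h2
      exact ae_of_ae_map (measurable_pi_apply v).aemeasurable h2
    filter_upwards [ae_all_iff.2 h1] with x hx
    choose z hz using hx
    exact ⟨z, funext hz⟩
  let γ := γ'.comap Φ
  have hγ : γ.map Φ = γ' := by
    rw [hΦ.map_comap, Measure.restrict_eq_self_of_ae_mem hrange]
  have hγprob : IsProbabilityMeasure γ := by
    constructor
    rw [← Set.preimage_univ (f := Φ), ← hΦ.map_apply, hγ, measure_univ]
  refine ⟨γ, C, u, ⟨hγprob, fun v => ?_⟩, hu, fun x => ?_, ?_⟩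
  · have h1 : (γ.map fun x => x v).map (j v) = (μ v).map (j v) := by
      rw [Measure.map_map (hj v).measurable (measurable_pi_apply v)]
      have : (j v ∘ fun x : (v : V) → X v => x v) = (fun x : V → Y => x v) ∘ Φ := rfl
      rw [this, ← Measure.map_map (measurable_pi_apply v) hΦ.measurable, hγ, hmarg]
    rw [← (hj v).comap_map (γ.map fun x => x v), h1, (hj v).comap_map]
  · rw [← hfΦ]
    exact (hu' _).trans_eq (Finset.sum_congr rfl fun v _ => (huu' v _).symm)
  · calc ∫ x, surplus G X x ∂γ = ∫ x, f (Φ x) ∂γ := by simp only [hfΦ]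
      _ = ∫ x, f x ∂γ' := by rw [← hΦ.integral_map, hγ]
      _ = ∑ v, ∫ y, u' v y ∂ν v := by rw [hval, hJ]
      _ = ∑ v, ∫ y, u v y ∂μ v := by
        refine Finset.sum_congr rfl fun v _ => ?_
        rw [(hj v).integral_map]
        exact integral_congr_ae (Filter.Eventually.of_forall fun y => (huu' v (j v y)).symm)

end Transfer

/-! ### Exchangeable families of differences -/

section Exchange

/-- The sum of the vectors `d v`, `v ∈ P`. -/
noncomputable def total {V E : Type*} [Fintype V] [AddCommMonoid E] (d : V → E) (P : Set V) : E :=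
  ∑ v, P.indicator d v

theorem total_sub {V E : Type*} [Fintype V] [AddCommGroup E] (x y : V → E) (P : Set V) :
    total (x - y) P = total x P - total y P := by
  simp only [total, Set.indicator_sub', Pi.sub_apply, Finset.sum_sub_distrib]

variable {V : Type*} [Fintype V] {E : Type*} [NormedAddCommGroup E] [InnerProductSpace ℝ E]
  {G : SimpleGraph V}

/-- A set of families of vectors which behaves like the differences `x - y` between a fixed point
`x` and the points `y` of a set on which the surplus equals a sum of potentials that are
differentiable at the vertices in `R`. -/
structure IsExchangeable (G : SimpleGraph V) (R : Set V) (D : Set (V → E)) : Prop where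
  pairing_nonneg : ∀ d ∈ D, ∀ T : Set V, 0 ≤ pairing G (T.indicator d) (Tᶜ.indicator d)
  indicator_mem : ∀ d ∈ D, ∀ T : Set V, pairing G (T.indicator d) (Tᶜ.indicator d) = 0 →
    T.indicator d ∈ D
  total_neighborSet : ∀ d ∈ D, ∀ v ∈ R, d v = 0 → total d (G.neighborSet v) = 0

theorem pairing_comm (x y : V → E) : pairing G x y = pairing G y x := by
  classical
  unfold pairing
  rw [Finset.sum_comm]
  exact Finset.sum_congr rfl fun s _ => Finset.sum_congr rfl fun t _ =>
    if_congr (G.adj_comm t s) (real_inner_comm _ _) rfl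

theorem pairing_add_left (x y z : V → E) :
    pairing G (x + y) z = pairing G x z + pairing G y z := by
  simp only [pairing, ← Finset.sum_add_distrib]
  refine Finset.sum_congr rfl fun s _ => Finset.sum_congr rfl fun t _ => ?_
  split_ifs <;> simp [inner_add_left]

theorem pairing_add_right (x y z : V → E) :
    pairing G x (y + z) = pairing G x y + pairing G x z := by
  rw [pairing_comm, pairing_add_left, pairing_comm y, pairing_comm z]

theorem pairing_eq_sum_inner_total (x y : V → E) :
    pairing G x y = ∑ s, inner ℝ (x s) (total y (G.neighborSet s)) := by
  classical
  refine Finset.sum_congr rfl fun s _ => ?_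
  rw [total, inner_sum]
  refine Finset.sum_congr rfl fun t _ => ?_
  by_cases h : G.Adj s t <;> simp [Set.indicator, h]

/-- Exchanging the coordinates outside `T` of two points changes the surplus by the interaction
across the cut `T`. -/
theorem pairing_exchange (y e f : V → E) :
    pairing G (y + e + f) (y + e + f) + pairing G y y -
      (pairing G (y + e) (y + e) + pairing G (y + f) (y + f)) = 2 * pairing G e f := by
  simp only [pairing_add_left, pairing_add_right]
  rw [pairing_comm f e]
  ring

end Exchange

/-! ### The contact set and reduction to combinatorics -/

section Uniqueness

open scoped NNReal

variable {V : Type*} [Fintype V] {n : ℕ} {X : V → Set (EuclideanSpace ℝ (Fin n))}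
  {G : SimpleGraph V} {u : V → EuclideanSpace ℝ (Fin n) → ℝ}

/-- The points at which the potentials `u` are tight, and differentiable at the coordinates with
index in `R`. -/
def contactSet (G : SimpleGraph V) (X : V → Set (EuclideanSpace ℝ (Fin n)))
    (u : V → EuclideanSpace ℝ (Fin n) → ℝ) (R : Set V) : Set ((v : V) → X v) :=
  {x | surplus G X x = ∑ v, u v (x v) ∧ ∀ v ∈ R, DifferentiableAt ℝ (u v) (x v)}

/-- Swapping coordinates between `x` and `y` preserves the sum of the potentials and lowers the
total surplus by the interaction across `T`. Domination makes this nonnegative; if it is zero, both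
swapped points are tight, and `y'` is the required `z`. -/
theorem exchange_of_mem_contactSet {R : Set V} (hu : ∀ x, surplus G X x ≤ ∑ v, u v (x v))
    {x y : (v : V) → X v} (hx : x ∈ contactSet G X u R) (hy : y ∈ contactSet G X u R) {d : V → _}
    (hd : d = fun v => (x v : EuclideanSpace ℝ (Fin n)) - y v) (T : Set V) :
    0 ≤ pairing G (T.indicator d) (Tᶜ.indicator d) ∧
      (pairing G (T.indicator d) (Tᶜ.indicator d) = 0 → ∃ z ∈ contactSet G X u R,
        T.indicator d = fun v => (x v : EuclideanSpace ℝ (Fin n)) - z v) := by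
  classical
  set x' := T.piecewise x y with hx'
  set y' := T.piecewise y x with hy'
  have hsum : ∑ v, u v (x' v) + ∑ v, u v (y' v) = ∑ v, u v (x v) + ∑ v, u v (y v) := by
    rw [← Finset.sum_add_distrib, ← Finset.sum_add_distrib]
    refine Finset.sum_congr rfl fun v _ => ?_
    by_cases hv : v ∈ T <;> simp [x', y', hv, add_comm]
  have h0 : (fun v => (x v : EuclideanSpace ℝ (Fin n))) =
      (fun v => (y v : EuclideanSpace ℝ (Fin n))) + T.indicator d + Tᶜ.indicator d := by
    funext v
    by_cases hv : v ∈ T <;> simp [hv, hd]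
  have h1 : (fun v => (x' v : EuclideanSpace ℝ (Fin n))) =
      (fun v => (y v : EuclideanSpace ℝ (Fin n))) + T.indicator d := by
    funext v
    by_cases hv : v ∈ T <;> simp [x', hv, hd]
  have h2 : (fun v => (y' v : EuclideanSpace ℝ (Fin n))) =
      (fun v => (y v : EuclideanSpace ℝ (Fin n))) + Tᶜ.indicator d := by
    funext v
    by_cases hv : v ∈ T <;> simp [y', hv, hd]
  have hex : surplus G X x + surplus G X y - (surplus G X x' + surplus G X y') =
      pairing G (T.indicator d) (Tᶜ.indicator d) := by
    have := pairing_exchange (G := G) (fun v => (y v : EuclideanSpace ℝ (Fin n)))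
      (T.indicator d) (Tᶜ.indicator d)
    rw [← h0, ← h1, ← h2] at this
    simp only [surplus_eq_pairing]
    linarith
  have hux := hu x'
  have huy := hu y'
  have hx1 := hx.1
  have hy1 := hy.1
  refine ⟨by linarith, fun h => ⟨y', ⟨by linarith, fun v hv => ?_⟩, ?_⟩⟩
  · by_cases hvT : v ∈ T
    · simpa [y', hvT] using hy.2 v hv
    · simpa [y', hvT] using hx.2 v hv
  · funext v
    by_cases hv : v ∈ T <;> simp [y', hv, hd]

/-- As `G` has no loops, the surplus is affine in the coordinate `v`, with slope the sum of the
neighboring coordinates. Tightness makes `u v` minus this linear form locally minimal at `x v`. -/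
theorem fderiv_potential_of_mem_contactSet {R : Set V} (hXo : ∀ v, IsOpen (X v))
    (hu : ∀ x, surplus G X x ≤ ∑ v, u v (x v)) {x : (v : V) → X v}
    (hx : x ∈ contactSet G X u R) {v : V} (hv : v ∈ R) :
    fderiv ℝ (u v) (x v) = innerSL ℝ (total (fun v => (x v : EuclideanSpace ℝ (Fin n)))
      (G.neighborSet v)) := by
  classical
  set N := total (fun v => (x v : EuclideanSpace ℝ (Fin n))) (G.neighborSet v) with hN
  have hmin : IsLocalMin (fun z => u v z - innerSL ℝ N z) (x v) := by
    filter_upwards [(hXo v).mem_nhds (x v).2] with z hz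
    set x' := Function.update x v ⟨z, hz⟩ with hx'
    set e : V → EuclideanSpace ℝ (Fin n) := Pi.single v (z - x v) with he
    have h1 : (fun w => (x' w : EuclideanSpace ℝ (Fin n))) =
        (fun w => (x w : EuclideanSpace ℝ (Fin n))) + e := by
      funext w
      by_cases hw : w = v
      · subst hw; simp [x', e]
      · simp [x', e, hw]
    have h2 : ∀ y : V → EuclideanSpace ℝ (Fin n),
        pairing G e y = inner ℝ (z - x v) (total y (G.neighborSet v)) := fun y => by
      rw [pairing_eq_sum_inner_total, Finset.sum_eq_single v] <;> simp +contextual [e]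
    have h3 : total e (G.neighborSet v) = 0 := by
      refine Finset.sum_eq_zero fun w _ => ?_
      by_cases hw : w = v
      · subst hw; simp
      · simp [Set.indicator, e, hw]
    have h4 : surplus G X x' = surplus G X x + inner ℝ (z - x v) N := by
      rw [surplus_eq_pairing, surplus_eq_pairing, h1]
      simp only [pairing_add_left, pairing_add_right]
      rw [pairing_comm _ e, h2, h2, h3, inner_zero_right, ← hN]
      ring
    have h5 : ∑ w, u w (x' w) = ∑ w, u w (x w) + (u v z - u v (x v)) := by
      rw [← sub_eq_iff_eq_add', ← Finset.sum_sub_distrib, Finset.sum_eq_single v] <;>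
        simp +contextual [x']
    have h6 := hu x'
    rw [h4, h5, hx.1, inner_sub_left, real_inner_comm, real_inner_comm N] at h6
    simp only [innerSL_apply_apply]
    linarith
  have h7 := hmin.fderiv_eq_zero
  rw [fderiv_fun_sub (hx.2 v hv) (innerSL ℝ N).differentiableAt, ContinuousLinearMap.fderiv] at h7
  exact sub_eq_zero.1 h7

theorem isExchangeable_contactSet {R : Set V} (hXo : ∀ v, IsOpen (X v))
    (hu : ∀ x, surplus G X x ≤ ∑ v, u v (x v)) {x : (v : V) → X v}
    (hx : x ∈ contactSet G X u R) :
    IsExchangeable G R {d | ∃ y ∈ contactSet G X u R,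
      d = fun v => (x v : EuclideanSpace ℝ (Fin n)) - y v} where
  pairing_nonneg := fun _ ⟨_, hy, hd⟩ T => (exchange_of_mem_contactSet hu hx hy hd T).1
  indicator_mem := fun _ ⟨_, hy, hd⟩ T => (exchange_of_mem_contactSet hu hx hy hd T).2
  total_neighborSet := by
    rintro _ ⟨y, hy, rfl⟩ v hv hxy
    have h := (fderiv_potential_of_mem_contactSet hXo hu hx hv).symm.trans
      ((congrArg (fderiv ℝ (u v)) (sub_eq_zero.1 hxy)).trans
        (fderiv_potential_of_mem_contactSet hXo hu hy hv))
    refine (total_sub _ _ _).trans (sub_eq_zero.2 (ext_inner_right ℝ fun w => ?_))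
    simpa only [innerSL_apply_apply] using DFunLike.congr_fun h w

theorem measurableSet_contactSet (hu : ∀ v, Continuous (u v)) (R : Set V) :
    MeasurableSet (contactSet G X u R) := by
  refine MeasurableSet.inter ?_ ?_
  · exact measurableSet_eq_fun (continuous_surplus G).measurable
      (continuous_finsetSum _ fun v _ => (hu v).comp
        (continuous_subtype_val.comp (continuous_apply v))).measurable
  · have : {x : (v : V) → X v | ∀ v ∈ R, DifferentiableAt ℝ (u v) (x v)} =
        ⋂ v ∈ R, (fun x : (v : V) → X v => (x v : EuclideanSpace ℝ (Fin n))) ⁻¹'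
          {z | DifferentiableAt ℝ (u v) z} := by ext; simp
    change MeasurableSet {x : (v : V) → X v | ∀ v ∈ R, DifferentiableAt ℝ (u v) (x v)}
    rw [this]
    exact MeasurableSet.biInter (Set.to_countable R) fun v _ =>
      (measurable_subtype_coe.comp (measurable_pi_apply v))
        (measurableSet_of_differentiableAt ℝ (u v))

/-- Measurable injective images of Borel sets are measurable, so the mass of `s` can be read off as
the mass of `f '' (s ∩ W)` under the pushforward. -/
theorem eq_of_injOn_of_map_eq {A B : Type*} [MeasurableSpace A] [StandardBorelSpace A]
    [MeasurableSpace B] [MeasurableSpace.CountablySeparated B] {f : A → B} (hf : Measurable f)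
    {W : Set A} (hW : MeasurableSet W) (hinj : Set.InjOn f W) {γ₁ γ₂ : Measure A}
    (h₁ : ∀ᵐ x ∂γ₁, x ∈ W) (h₂ : ∀ᵐ x ∂γ₂, x ∈ W) (h : γ₁.map f = γ₂.map f) : γ₁ = γ₂ := by
  ext s hs
  have hm : MeasurableSet (f '' (s ∩ W)) :=
    (hs.inter hW).image_of_measurable_injOn hf (hinj.mono Set.inter_subset_right)
  have key : ∀ γ : Measure A, (∀ᵐ x ∂γ, x ∈ W) → γ s = γ.map f (f '' (s ∩ W)) := fun γ hγ => by
    rw [Measure.map_apply hf hm]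
    refine measure_congr ?_
    filter_upwards [hγ] with x hx
    refine propext ⟨fun hxs => ⟨x, ⟨hxs, hx⟩, rfl⟩, ?_⟩
    rintro ⟨y, ⟨hys, hyW⟩, hyx⟩
    exact hinj hyW hx hyx ▸ hys
  rw [key γ₁ h₁, key γ₂ h₂, h]

/-- If exchangeable families vanish as soon as they vanish at `v₁`, then the Kantorovich problem has
exactly one solution. -/
theorem existsUnique_isKantorovichSolution
    (hXo : ∀ v, IsOpen (X v)) (hXb : ∀ v, Bornology.IsBounded (X v))
    (μ : (v : V) → Measure (X v)) (hμ : ∀ v, IsProbabilityMeasure (μ v)) (v₁ : V)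
    (hG : ∀ D : Set (V → EuclideanSpace ℝ (Fin n)), IsExchangeable G {v | IsAC (μ v)} D →
      ∀ d ∈ D, d v₁ = 0 → d = 0) :
    ∃! γ : Measure ((v : V) → X v), IsKantorovichSolution G μ γ := by
  have : Nonempty V := ⟨v₁⟩
  obtain ⟨γ, C, u, hγ, huL, hu, hval⟩ := exists_plan_and_potentials hXo hXb μ hμ G
  obtain ⟨B, hB⟩ : ∃ B, ∀ x, ‖surplus G X x‖ ≤ B := by
    obtain ⟨r, hr⟩ := ((Bornology.isBounded_iUnion).2 hXb).subset_closedBall 0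
    have hr' : ∀ (x : (v : V) → X v) v, (x v : EuclideanSpace ℝ (Fin n)) ∈
        Metric.closedBall 0 r := fun x v => hr (Set.mem_iUnion_of_mem v (x v).2)
    have hK := isCompact_univ_pi fun _ : V =>
      isCompact_closedBall (0 : EuclideanSpace ℝ (Fin n)) r
    obtain ⟨B, hB⟩ := hK.exists_bound_of_continuousOn
      (f := fun x : V → EuclideanSpace ℝ (Fin n) => pairing G x x / 2)
      ((continuous_pairing_self G).div_const 2).continuousOn
    exact ⟨B, fun x => by
      rw [surplus_eq_pairing]
      exact hB _ fun v _ => hr' x v⟩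
  have hint : ∀ γ' : Measure ((v : V) → X v), IsFiniteMeasure γ' →
      Integrable (surplus G X) γ' := fun γ' _ =>
    Integrable.of_bound (continuous_surplus G).aestronglyMeasurable B
      (Filter.Eventually.of_forall hB)
  have huint : ∀ v, Integrable (fun y : X v => u v y) (μ v) := fun v => by
    obtain ⟨c, hc⟩ := ((hXb v).isCompact_closure).exists_bound_of_continuousOn
      (f := u v) (huL v).continuous.continuousOn
    exact Integrable.of_bound
      ((huL v).continuous.comp continuous_subtype_val).aestronglyMeasurable c
      (Filter.Eventually.of_forall fun y => hc y (subset_closure y.2))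
  have hcomp : ∀ γ', IsTransportPlan μ γ' → ∀ v,
      Integrable (fun x : (v : V) → X v => u v (x v)) γ' ∧
        ∫ x, u v (x v) ∂γ' = ∫ y, u v y ∂μ v := fun γ' hγ' v => by
    have h1 := huint v
    rw [← hγ'.2 v] at h1 ⊢
    rw [integral_map (measurable_pi_apply v).aemeasurable h1.aestronglyMeasurable]
    exact ⟨h1.comp_measurable (measurable_pi_apply v), rfl⟩
  have hsum : ∀ γ', IsTransportPlan μ γ' →
      Integrable (fun x : (v : V) → X v => ∑ v, u v (x v)) γ' ∧
        ∫ x, ∑ v, u v (x v) ∂γ' = ∫ x, surplus G X x ∂γ := fun γ' hγ' => by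
    rw [hval, integral_finsetSum _ fun v _ => (hcomp γ' hγ' v).1]
    exact ⟨integrable_finsetSum _ fun v _ => (hcomp γ' hγ' v).1,
      Finset.sum_congr rfl fun v _ => (hcomp γ' hγ' v).2⟩
  have hsol : IsKantorovichSolution G μ γ := ⟨hγ, fun γ' hγ' => by
    have := hγ'.1
    rw [← (hsum γ' hγ').2]
    exact integral_mono (hint γ' inferInstance) (hsum γ' hγ').1 hu⟩
  set R : Set V := {v | IsAC (μ v)} with hR
  have hW : ∀ γ', IsKantorovichSolution G μ γ' → ∀ᵐ x ∂γ', x ∈ contactSet G X u R := by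
    intro γ' hγ'
    have := hγ'.1.1
    have h1 : ∀ᵐ x ∂γ', surplus G X x = ∑ v, u v (x v) := by
      have h2 : 0 ≤ᵐ[γ'] fun x : (v : V) → X v => ∑ v, u v (x v) - surplus G X x :=
        Filter.Eventually.of_forall fun x => sub_nonneg.2 (hu x)
      have hi := hint γ' inferInstance
      -- The potentials have the same integral under every plan, namely the optimal value, so the
      -- nonnegative slack of a solution integrates to zero.
      have h3 : ∫ x, (∑ v, u v (x v) - surplus G X x) ∂γ' = 0 := by
        refine le_antisymm ?_ (integral_nonneg_of_ae h2)
        rw [integral_sub (hsum γ' hγ'.1).1 hi, (hsum γ' hγ'.1).2, sub_nonpos]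
        exact hγ'.2 γ hγ
      have h4 := (integral_eq_zero_iff_of_nonneg_ae h2 ((hsum γ' hγ'.1).1.sub hi)).1 h3
      filter_upwards [h4] with x hx
      exact (sub_eq_zero.1 hx).symm
    have h5 : ∀ᵐ x ∂γ', ∀ v ∈ R, DifferentiableAt ℝ (u v) (x v) := by
      rw [ae_ball_iff (Set.to_countable R)]
      intro v hv
      have hac : (μ v).map ((↑) : X v → EuclideanSpace ℝ (Fin n)) ≪ volume := hv
      have h6 : ∀ᵐ y : X v ∂μ v, DifferentiableAt ℝ (u v) y :=
        ae_of_ae_map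
          measurable_subtype_coe.aemeasurable ((huL v).ae_differentiableAt.filter_mono hac.ae_le)
      rw [← hγ'.1.2 v] at h6
      exact ae_of_ae_map (measurable_pi_apply v).aemeasurable h6
    filter_upwards [h1, h5] with x hx1 hx2
    exact ⟨hx1, hx2⟩
  have hinj : Set.InjOn (fun x : (v : V) → X v => x v₁) (contactSet G X u R) := by
    intro x hx y hy hxy
    have h0 := hG _ (isExchangeable_contactSet hXo hu hx) _ ⟨y, hy, rfl⟩
      (sub_eq_zero.2 (congrArg Subtype.val hxy))
    exact funext fun v => Subtype.ext (sub_eq_zero.1 (congrFun h0 v))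
  have := fun v => (hXo v).polishSpace
  refine ⟨γ, hsol, fun γ' hγ' => ?_⟩
  exact eq_of_injOn_of_map_eq (measurable_pi_apply v₁)
    (measurableSet_contactSet (fun v => (huL v).continuous) R) hinj (hW γ' hγ') (hW γ hsol)
    ((hγ'.1.2 v₁).trans (hγ.2 v₁).symm)

end Uniqueness

/-! ### Sums over sets of vertices -/

section Total

variable {V E : Type*} [Fintype V] [AddCommGroup E]

theorem total_indicator (d : V → E) (T P : Set V) :
    total (T.indicator d) P = total d (P ∩ T) := by
  simp only [total, Set.indicator_indicator]

theorem total_union {d : V → E} {P Q : Set V} (h : Disjoint P Q) :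
    total d (P ∪ Q) = total d P + total d Q := by
  simp only [total, Set.indicator_union_of_disjoint h, Finset.sum_add_distrib]

theorem total_inter_add_diff (d : V → E) (P Q : Set V) :
    total d (P ∩ Q) + total d (P \ Q) = total d P := by
  rw [← total_union (Set.disjoint_sdiff_right.mono_left Set.inter_subset_right),
    Set.inter_union_sdiff]

theorem total_eq_zero {d : V → E} {P : Set V} (h : ∀ v ∈ P, d v = 0) : total d P = 0 :=
  Finset.sum_eq_zero fun v _ => Set.indicator_apply_eq_zero.2 (h v)

theorem total_singleton (d : V → E) (v : V) : total d {v} = d v := by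
  classical
  rw [total, Finset.sum_eq_single v] <;> simp +contextual

theorem total_eq_of_eq_diff {d : V → E} {v : V} {N K : Set V} (hN : N = K \ {v}) (hv : v ∈ K) :
    total d K = d v + total d N := by
  rw [hN, ← total_inter_add_diff d K {v}, Set.inter_eq_right.2 (Set.singleton_subset_iff.2 hv),
    total_singleton]

end Total

/-! ### Complete bipartite cuts -/

section Cuts

variable {V : Type*} {G : SimpleGraph V}

/-- The edges between `T` and its complement are exactly the pairs of an element of `P` and an
element of `Q`. -/
structure IsCut (G : SimpleGraph V) (T P Q : Set V) : Prop where
  left_subset : P ⊆ T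
  right_subset : Q ⊆ Tᶜ
  adj_iff : ∀ s ∈ T, ∀ t ∉ T, G.Adj s t ↔ s ∈ P ∧ t ∈ Q

theorem IsCut.compl {T P Q : Set V} (h : IsCut G T P Q) : IsCut G Tᶜ Q P where
  left_subset := h.right_subset
  right_subset := by rw [compl_compl]; exact h.left_subset
  adj_iff s hs t ht := by
    rw [G.adj_comm, h.adj_iff t (not_not.1 ht) s hs, and_comm]

theorem isCut_singleton (i : V) : IsCut G {i} {i} (G.neighborSet i) where
  left_subset := le_rfl
  right_subset := by rintro x hx rfl; exact G.loopless.irrefl _ hx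
  adj_iff := by rintro s rfl t -; simp

variable [Fintype V] {E : Type*} [NormedAddCommGroup E] [InnerProductSpace ℝ E]
  {R T P Q : Set V} {D : Set (V → E)} {d : V → E}

theorem IsCut.pairing_eq (h : IsCut G T P Q) (d : V → E) :
    pairing G (T.indicator d) (Tᶜ.indicator d) = inner ℝ (total d P) (total d Q) := by
  classical
  rw [pairing, total, sum_inner]
  refine Finset.sum_congr rfl fun s _ => ?_
  rw [total, inner_sum]
  refine Finset.sum_congr rfl fun t _ => ?_
  by_cases hs : s ∈ T
  · by_cases ht : t ∈ T
    · have : t ∉ Q := fun htQ => h.right_subset htQ ht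
      simp [ht, this]
    · have := h.adj_iff s hs t ht
      by_cases hsP : s ∈ P <;> by_cases htQ : t ∈ Q <;> simp_all
  · have : s ∉ P := fun hsP => hs (h.left_subset hsP)
    simp [hs, this]

namespace IsExchangeable

theorem inner_total_nonneg (hD : IsExchangeable G R D) (hd : d ∈ D) (h : IsCut G T P Q) :
    0 ≤ inner ℝ (total d P) (total d Q) :=
  h.pairing_eq d ▸ hD.pairing_nonneg d hd T

/-- The interaction is the inner product of two opposite vectors, hence nonpositive; exchangeability
makes it nonnegative. -/
theorem total_left_eq_zero (hD : IsExchangeable G R D) (hd : d ∈ D) (h : IsCut G T P Q)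
    (hPQ : total d P + total d Q = 0) : total d P = 0 := by
  have := hD.inner_total_nonneg hd h
  rw [eq_neg_of_add_eq_zero_right hPQ, inner_neg_right, neg_nonneg] at this
  exact inner_self_eq_zero.1 (this.antisymm real_inner_self_nonneg)

theorem total_right_eq_zero (hD : IsExchangeable G R D) (hd : d ∈ D) (h : IsCut G T P Q)
    (hPQ : total d P + total d Q = 0) : total d Q = 0 := by
  rwa [hD.total_left_eq_zero hd h hPQ, zero_add] at hPQ

theorem indicator_mem_of_left (hD : IsExchangeable G R D) (hd : d ∈ D) (h : IsCut G T P Q)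
    (hP : total d P = 0) : T.indicator d ∈ D :=
  hD.indicator_mem d hd T (by rw [h.pairing_eq, hP, inner_zero_left])

theorem indicator_mem_of_right (hD : IsExchangeable G R D) (hd : d ∈ D) (h : IsCut G T P Q)
    (hQ : total d Q = 0) : T.indicator d ∈ D :=
  hD.indicator_mem d hd T (by rw [h.pairing_eq, hQ, inner_zero_right])

theorem total_eq_zero_of_mem (hD : IsExchangeable G R D) (hd : d ∈ D) {v : V} {K : Set V}
    (hv : v ∈ R) (hdv : d v = 0) (hvK : v ∈ K) (hN : G.neighborSet v = K \ {v}) :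
    total d K = 0 := by
  rw [total_eq_of_eq_diff hN hvK, hdv, zero_add, hD.total_neighborSet d hd v hv hdv]

theorem apply_eq_zero (hD : IsExchangeable G R D) (hd : d ∈ D) {v : V} {K : Set V}
    (hK : total d K = 0) (hvK : v ∈ K) (hN : G.neighborSet v = K \ {v}) : d v = 0 := by
  rw [total_eq_of_eq_diff hN hvK, ← total_singleton d v] at hK
  rw [← total_singleton d v]
  exact hD.total_left_eq_zero hd (isCut_singleton v) hK

/-- `d` vanishes at a vertex adjacent to a vertex of `R` if its sum over the neighbors of that
vertex vanishes. -/
theorem apply_eq_zero_of_adj (hD : IsExchangeable G R D) (hd : d ∈ D) {v i : V} (hv : v ∈ R)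
    (hi : G.Adj v i) (h : total d (G.neighborSet i) = 0) : d i = 0 := by
  -- The truncation of `d` to `{i}` is still in `D` and vanishes at `v`, so its neighbor total at
  -- `v`, which is `d i`, is zero.
  have h1 := hD.indicator_mem_of_right hd (isCut_singleton i) h
  have h2 := hD.total_neighborSet _ h1 v hv (by simp [hi.ne])
  have h3 : G.neighborSet v ∩ {i} = {i} := Set.inter_eq_right.2 (Set.singleton_subset_iff.2 hi)
  rwa [total_indicator, h3, total_singleton] at h2

end IsExchangeable

end Cuts

/-! ### Structure of graphs with an inner hub -/

section Hubs

variable {V : Type*} {H : SimpleGraph V} {S : H.Subgraph} {A : Set V}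

theorem IsMaximalClique.subset {C : Set V} (h : IsMaximalClique S C) : C ⊆ S.verts := h.prop.1

theorem IsMaximalClique.eq_of_subset {C D : Set V} (h : IsMaximalClique S C) (hCD : C ⊆ D)
    (hD : D ⊆ S.verts) (hD' : D.Pairwise S.Adj) : C = D :=
  Maximal.eq_of_le h ⟨hD, hD'⟩ hCD

theorem IsInnerHub.eq_or_exists (h : IsInnerHub S A) :
    IsMaximalClique S A ∧ (∀ D, IsMaximalClique S D → D = A) ∨
      ∀ C, IsMaximalClique S C → ∃ D, IsMaximalClique S D ∧ C ∩ D = A := by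
  by_cases hu : ∀ C, IsMaximalClique S C → ∃ D, IsMaximalClique S D ∧ D ≠ C
  · right
    intro C hC
    obtain ⟨D, hD, hDC⟩ := hu C hC
    exact ⟨D, hD, h.1 C D hC hD hDC.symm⟩
  · push Not at hu
    obtain ⟨C, hC, hCD⟩ := hu
    obtain rfl := h.2 C hC hCD
    exact Or.inl ⟨hC, hCD⟩

theorem IsInnerHub.subset_isMaximalClique (h : IsInnerHub S A) {C : Set V}
    (hC : IsMaximalClique S C) : A ⊆ C := by
  rcases h.eq_or_exists with ⟨-, h2⟩ | h2
  · exact (h2 C hC).ge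
  · obtain ⟨D, -, hD⟩ := h2 C hC
    exact hD ▸ Set.inter_subset_left

theorem IsInnerHub.eq_verts_of_isComplete (h : IsInnerHub S A) (hS : IsComplete S) :
    A = S.verts := by
  refine h.2 _ ⟨⟨le_rfl, hS⟩, fun D hD _ => hD.1⟩ fun D hD => ?_
  exact hD.eq_of_subset hD.subset le_rfl hS

variable [Finite V]

theorem exists_isMaximalClique_superset {D : Set V} (hD : D ⊆ S.verts) (hD' : D.Pairwise S.Adj) :
    ∃ C, IsMaximalClique S C ∧ D ⊆ C := by
  obtain ⟨C, h, hC⟩ := Finite.exists_le_maximal 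
    (p := fun D : Set V => D ⊆ S.verts ∧ D.Pairwise S.Adj) ⟨hD, hD'⟩
  exact ⟨C, hC, h⟩

theorem IsInnerHub.subset_verts (h : IsInnerHub S A) : A ⊆ S.verts := by
  obtain ⟨C, hC, -⟩ := exists_isMaximalClique_superset (S := S) (Set.empty_subset _)
    (Set.pairwise_empty _)
  exact (h.subset_isMaximalClique hC).trans hC.subset

theorem IsInnerHub.adj (h : IsInnerHub S A) {a b : V} (ha : a ∈ A) (hb : b ∈ S.verts)
    (hab : a ≠ b) : S.Adj a b := by
  obtain ⟨C, hC, hbC⟩ := exists_isMaximalClique_superset (S := S) (Set.singleton_subset_iff.2 hb)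
    (Set.pairwise_singleton _ _)
  exact hC.prop.2 (h.subset_isMaximalClique hC ha) (hbC rfl) hab

theorem exists_isMaximalClique_of_adj {a b : V} (hab : S.Adj a b) :
    ∃ C, IsMaximalClique S C ∧ a ∈ C ∧ b ∈ C := by
  obtain ⟨C, hC, h⟩ := exists_isMaximalClique_superset (S := S) (D := {a, b})
    (Set.insert_subset hab.fst_mem (Set.singleton_subset_iff.2 hab.snd_mem))
    (Set.pairwise_pair.2 fun _ => ⟨hab, hab.symm⟩)
  exact ⟨C, hC, h (by simp), h (by simp)⟩

/-- A vertex outside the hub lies in only one maximal clique. -/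
theorem IsInnerHub.adj_trans (h : IsInnerHub S A) {a b c : V} (hb : b ∉ A) (hab : S.Adj a b)
    (hbc : S.Adj b c) (hac : a ≠ c) : S.Adj a c := by
  obtain ⟨C, hC, haC, hbC⟩ := exists_isMaximalClique_of_adj hab
  obtain ⟨D, hD, hbD, hcD⟩ := exists_isMaximalClique_of_adj hbc
  have : C = D := by
    by_contra hCD
    exact hb (h.1 C D hC hD hCD ▸ ⟨hbC, hbD⟩)
  exact hC.prop.2 haC (this ▸ hcD) hac

/-- The vertices outside the hub `A` of the maximal clique of `i`, for `i` outside the hub. -/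
def petal (S : H.Subgraph) (A : Set V) (i : V) : Set V :=
  {j | j ∈ S.verts ∧ j ∉ A ∧ (j = i ∨ S.Adj i j)}

theorem IsInnerHub.pairwise_union_petal (h : IsInnerHub S A) {i : V} (hi : i ∉ A) :
    (A ∪ petal S A i).Pairwise S.Adj := by
  have hsub : A ∪ petal S A i ⊆ S.verts :=
    Set.union_subset h.subset_verts fun _ hj => hj.1
  rintro x (hx | hx) y hy hxy
  · exact h.adj hx (hsub hy) hxy
  · rcases hy with hy | hy
    · exact (h.adj hy hx.1 hxy.symm).symm
    · rcases hx.2.2 with rfl | hx'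
      · exact hy.2.2.resolve_left hxy.symm
      · rcases hy.2.2 with rfl | hy'
        · exact hx'.symm
        · exact h.adj_trans hi hx'.symm hy' hxy

theorem IsInnerHub.isMaximalClique_eq (h : IsInnerHub S A) {C : Set V} (hC : IsMaximalClique S C)
    {i : V} (hiC : i ∈ C) (hi : i ∉ A) : C = A ∪ petal S A i := by
  refine hC.eq_of_subset (fun j hj => ?_) (Set.union_subset h.subset_verts fun _ hj => hj.1)
    (h.pairwise_union_petal hi)
  by_cases hjA : j ∈ A
  · exact Or.inl hjA
  · refine Or.inr ⟨hC.subset hj, hjA, ?_⟩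
    by_cases hji : j = i
    · exact Or.inl hji
    · exact Or.inr (hC.prop.2 hiC hj (Ne.symm hji))

theorem IsInnerHub.adj_iff_of_mem (h : IsInnerHub S A) {a b : V} (ha : a ∈ A) :
    S.Adj a b ↔ b ∈ S.verts \ {a} :=
  ⟨fun hab => ⟨hab.snd_mem, hab.ne.symm⟩, fun hb => h.adj ha hb.1 (Ne.symm hb.2)⟩

theorem IsInnerHub.adj_iff_of_notMem (h : IsInnerHub S A) {i j : V} (hiS : i ∈ S.verts)
    (hi : i ∉ A) : S.Adj i j ↔ j ∈ (A ∪ petal S A i) \ {i} := by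
  have hmem : i ∈ A ∪ petal S A i := Or.inr ⟨hiS, hi, Or.inl rfl⟩
  refine ⟨fun hij => ⟨?_, hij.ne.symm⟩, fun hj =>
    h.pairwise_union_petal hi hmem hj.1 (Ne.symm hj.2)⟩
  by_cases hjA : j ∈ A
  · exact Or.inl hjA
  · exact Or.inr ⟨hij.snd_mem, hjA, Or.inr hij⟩

theorem IsInnerHub.petal_eq (h : IsInnerHub S A) {i j : V} (hi : i ∉ A) (hj : j ∈ petal S A i) :
    petal S A j = petal S A i := by
  have aux : ∀ {i j : V}, i ∉ A → j ∈ petal S A i → petal S A i ⊆ petal S A j := by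
    intro i j hi hj k hk
    refine ⟨hk.1, hk.2.1, ?_⟩
    by_cases hkj : k = j
    · exact Or.inl hkj
    · exact Or.inr (h.pairwise_union_petal hi (Or.inr hj) (Or.inr hk) (Ne.symm hkj))
  refine (aux hj.2.1 ?_).antisymm (aux hi hj)
  rcases hj.2.2 with rfl | hij
  · exact hj
  · exact ⟨hij.fst_mem, hi, Or.inr hij.symm⟩

end Hubs

/-! ### Complements of graphs with an inner hub -/

section Extraction

variable {V : Type*} {G H : SimpleGraph V} {S : H.Subgraph} {A : Set V}

theorem neighborSet_of_notMem_verts (hG : ∀ s t, G.Adj s t ↔ s ≠ t ∧ ¬ S.Adj s t)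
    {i : V} (hi : i ∉ S.verts) : G.neighborSet i = Set.univ \ {i} := by
  ext j
  have : ¬ S.Adj i j := fun h => hi h.fst_mem
  simp only [SimpleGraph.mem_neighborSet, hG]
  grind

variable [Fintype V]

theorem neighborSet_of_mem_hub (hG : ∀ s t, G.Adj s t ↔ s ≠ t ∧ ¬ S.Adj s t)
    (hS : IsInnerHub S A) {i : V} (hi : i ∈ A) : G.neighborSet i = S.vertsᶜ := by
  ext j
  have := hS.subset_verts hi
  simp only [SimpleGraph.mem_neighborSet, hG, hS.adj_iff_of_mem hi]
  grind

theorem neighborSet_of_notMem_hub (hG : ∀ s t, G.Adj s t ↔ s ≠ t ∧ ¬ S.Adj s t)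
    (hS : IsInnerHub S A) {i : V} (hiS : i ∈ S.verts) (hi : i ∉ A) :
    G.neighborSet i = (A ∪ petal S A i)ᶜ := by
  ext j
  have : i ∈ petal S A i := ⟨hiS, hi, Or.inl rfl⟩
  simp only [SimpleGraph.mem_neighborSet, hG, hS.adj_iff_of_notMem hiS hi]
  grind

theorem isCut_hub (hG : ∀ s t, G.Adj s t ↔ s ≠ t ∧ ¬ S.Adj s t) (hS : IsInnerHub S A) :
    IsCut G A A S.vertsᶜ where
  left_subset := le_rfl
  right_subset := Set.compl_subset_compl.2 hS.subset_verts
  adj_iff s hs t _ := by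
    rw [← SimpleGraph.mem_neighborSet, neighborSet_of_mem_hub hG hS hs]
    simp [hs]

theorem isCut_petal (hG : ∀ s t, G.Adj s t ↔ s ≠ t ∧ ¬ S.Adj s t) (hS : IsInnerHub S A) {i : V}
    (hi : i ∉ A) : IsCut G (petal S A i) (petal S A i) (A ∪ petal S A i)ᶜ where
  left_subset := le_rfl
  right_subset := Set.compl_subset_compl.2 Set.subset_union_right
  adj_iff s hs t _ := by
    rw [← SimpleGraph.mem_neighborSet, neighborSet_of_notMem_hub hG hS hs.1 hs.2.1,
      hS.petal_eq hi hs]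
    simp [hs]

theorem isCut_compl_verts_union_hub (hG : ∀ s t, G.Adj s t ↔ s ≠ t ∧ ¬ S.Adj s t)
    (hS : IsInnerHub S A) : IsCut G (S.vertsᶜ ∪ A) S.vertsᶜ (S.verts \ A) where
  left_subset := Set.subset_union_left
  right_subset := by
    intro x hx
    simp [hx.1, hx.2]
  adj_iff s hs t ht := by
    have hA := hS.subset_verts
    have htS : t ∈ S.verts \ A := by
      simp only [Set.mem_union, Set.mem_compl_iff] at ht
      grind
    by_cases hsS : s ∈ S.verts
    · have hsA : s ∈ A := by simpa [hsS] using hs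
      rw [← SimpleGraph.mem_neighborSet, neighborSet_of_mem_hub hG hS hsA]
      simp [htS.1, hsS]
    · rw [← SimpleGraph.mem_neighborSet, neighborSet_of_notMem_verts hG hsS]
      have : t ≠ s := fun h => hsS (h ▸ htS.1)
      simp [hsS, htS.1, htS.2, this]

variable {E : Type*} [NormedAddCommGroup E] [InnerProductSpace ℝ E]
  {R : Set V} {D : Set (V → E)} {d : V → E}

/-- If `d` vanishes on the hub and its total vanishes, then it vanishes at every vertex outside the
hub which is adjacent to a vertex of `R`. -/
theorem apply_eq_zero_of_hub_eq_zero (hG : ∀ s t, G.Adj s t ↔ s ≠ t ∧ ¬ S.Adj s t)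
    (hS : IsInnerHub S A) (hD : IsExchangeable G R D) (hd : d ∈ D) (hA : ∀ a ∈ A, d a = 0)
    (htot : total d Set.univ = 0) {v i : V} (hv : v ∈ R) (hvi : G.Adj v i) (hi : i ∉ A) :
    d i = 0 := by
  by_cases hiS : i ∈ S.verts
  · refine hD.apply_eq_zero_of_adj hd hv hvi ?_
    rw [neighborSet_of_notMem_hub hG hS hiS hi]
    refine hD.total_right_eq_zero hd (isCut_petal hG hS hi) ?_
    have hdisj : Disjoint A (petal S A i) := Set.disjoint_left.2 fun x hx hx' => hx'.2.1 hx
    have h1 := total_union (d := d) (disjoint_compl_right (a := A ∪ petal S A i))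
    rwa [Set.union_compl_self, htot, total_union hdisj, total_eq_zero hA, zero_add, eq_comm] at h1
  · exact hD.apply_eq_zero hd htot (Set.mem_univ i) (neighborSet_of_notMem_verts hG hiS)

theorem eq_zero_of_notMem_verts (hG : ∀ s t, G.Adj s t ↔ s ≠ t ∧ ¬ S.Adj s t)
    (hS : IsInnerHub S A) (hD : IsExchangeable G R D) (hd : d ∈ D) {v : V} (hv : v ∈ R)
    (hdv : d v = 0) (hvS : v ∉ S.verts) : d = 0 := by
  have hN := neighborSet_of_notMem_verts hG hvS
  have htot := hD.total_eq_zero_of_mem hd hv hdv (Set.mem_univ v) hN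
  have hO : ∀ i ∉ S.verts, d i = 0 := fun i hi =>
    hD.apply_eq_zero hd htot (Set.mem_univ i) (neighborSet_of_notMem_verts hG hi)
  have hadj : ∀ i, i ≠ v → G.Adj v i := fun i hi => by
    rw [← SimpleGraph.mem_neighborSet, hN]
    exact ⟨Set.mem_univ i, hi⟩
  have hA : ∀ i ∈ A, d i = 0 := fun i hi => by
    refine hD.apply_eq_zero_of_adj hd hv (hadj i ?_) ?_
    · rintro rfl; exact hvS (hS.subset_verts hi)
    · rw [neighborSet_of_mem_hub hG hS hi]
      exact total_eq_zero hO
  funext i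
  by_cases hiv : i = v
  · rw [hiv, hdv]; rfl
  by_cases hiA : i ∈ A
  · exact hA i hiA
  · exact apply_eq_zero_of_hub_eq_zero hG hS hD hd hA htot hv (hadj i hiv) hiA

/-- If `d` vanishes at a vertex `v ∈ R` of `S`, then it vanishes at the neighbors of `v`. -/
theorem eq_zero_of_adj_of_mem_verts (hG : ∀ s t, G.Adj s t ↔ s ≠ t ∧ ¬ S.Adj s t)
    (hS : IsInnerHub S A) (hD : IsExchangeable G R D) (hd : d ∈ D) {v : V} (hv : v ∈ R)
    (hdv : d v = 0) (hvS : v ∈ S.verts) (hvA : v ∈ A → A = S.verts) {i : V} (hi : G.Adj v i) :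
    d i = 0 := by
  have hAS := hS.subset_verts
  have hN0 := hD.total_neighborSet d hd v hv hdv
  have hiN : i ∈ G.neighborSet v := hi
  by_cases hvA' : v ∈ A
  · have hN := neighborSet_of_mem_hub hG hS hvA'
    rw [hN] at hN0 hiN
    have hAc : Aᶜ = S.vertsᶜ := by rw [← hvA hvA']
    have hd' := hD.indicator_mem_of_left hd (isCut_hub hG hS).compl hN0
    have htot : total (Aᶜ.indicator d) Set.univ = 0 := by
      rw [total_indicator, Set.univ_inter, hAc, hN0]
    have h := hD.apply_eq_zero hd' htot (Set.mem_univ i) (neighborSet_of_notMem_verts hG hiN)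
    rwa [Set.indicator_of_mem (hAc ▸ hiN)] at h
  · have hN := neighborSet_of_notMem_hub hG hS hvS hvA'
    rw [hN] at hN0 hiN
    set C := petal S A v with hC
    have hCS : C ⊆ S.verts := fun x hx => hx.1
    have hCA : ∀ x ∈ C, x ∉ A := fun x hx => hx.2.1
    -- Cut off first the petal of `v`, then the hub. In between, the cut separating `S.verts \ A`
    -- from the rest shows that the total outside `S.verts` vanishes, which the second truncation
    -- needs. The final family vanishes on the hub and has total zero.
    have hd1 := hD.indicator_mem_of_left hd (isCut_petal hG hS hvA').compl hN0
    have hAc : total (Cᶜ.indicator d) Aᶜ = 0 := by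
      rw [total_indicator, ← Set.compl_union, hN0]
    have hO : total (Cᶜ.indicator d) S.vertsᶜ = 0 := by
      refine hD.total_left_eq_zero hd1 (isCut_compl_verts_union_hub hG hS) ?_
      rw [← total_union (disjoint_compl_left.mono_right Set.sdiff_subset)]
      convert hAc using 2
      ext x
      have := @hAS x
      simp only [Set.mem_union, Set.mem_compl_iff, Set.mem_sdiff]
      tauto
    have hd2 := hD.indicator_mem_of_left hd1 (isCut_hub hG hS).compl hO
    have htot : total (Aᶜ.indicator (Cᶜ.indicator d)) Set.univ = 0 := by
      rw [total_indicator, Set.univ_inter, hAc]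
    have hiA : i ∉ A := fun h => hiN (Or.inl h)
    have hiC : i ∉ C := fun h => hiN (Or.inr h)
    have h := apply_eq_zero_of_hub_eq_zero hG hS hD hd2 (fun a ha => by simp [ha]) htot hv hi hiA
    rwa [Set.indicator_of_mem hiA, Set.indicator_of_mem hiC] at h

/-- Exchangeable families for the complement of a graph with an inner hub. -/
theorem eq_zero_of_extraction (hG : ∀ s t, G.Adj s t ↔ s ≠ t ∧ ¬ S.Adj s t)
    (hS : IsInnerHub S A) (hD : IsExchangeable G R D) (hd : d ∈ D) {v : V} (hv : v ∈ R)
    (hdv : d v = 0) (h : v ∉ S.verts ∨ ∃ p, G.Adj v p ∧ A ⊆ G.neighborSet p ∧ p ∈ R ∧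
      (¬ IsComplete S → v ∉ A)) : d = 0 := by
  by_cases hvS : v ∉ S.verts
  · exact eq_zero_of_notMem_verts hG hS hD hd hv hdv hvS
  obtain ⟨p, hvp, hAp, hp, hvA⟩ := h.resolve_left hvS
  rw [not_not] at hvS
  have hvA' : v ∈ A → A = S.verts := fun hv' =>
    hS.eq_verts_of_isComplete (by_contra fun hc => hvA hc hv')
  have hadj : ∀ i, G.Adj v i → d i = 0 := fun i hi =>
    eq_zero_of_adj_of_mem_verts hG hS hD hd hv hdv hvS hvA' hi
  -- A vertex not adjacent to `v` lies in the hub or in the petal of `v`. All its neighbors are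
  -- neighbors of `v`, where `d` is known to vanish, and the regular vertex `p` sees it.
  have hN : ∀ i, ¬ G.Adj v i → G.neighborSet i ⊆ G.neighborSet v ∧ G.Adj p i := by
    intro i hi
    by_cases hiA : i ∈ A
    · refine ⟨?_, hAp hiA⟩
      rw [neighborSet_of_mem_hub hG hS hiA]
      by_cases hvA'' : v ∈ A
      · rw [neighborSet_of_mem_hub hG hS hvA'']
      · rw [neighborSet_of_notMem_hub hG hS hvS hvA'', Set.compl_subset_compl]
        exact Set.union_subset hS.subset_verts fun x hx => hx.1
    · by_cases hvA'' : v ∈ A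
      · rw [← SimpleGraph.mem_neighborSet, neighborSet_of_mem_hub hG hS hvA'', ← hvA' hvA''] at hi
        exact absurd hiA hi
      · have hNv := neighborSet_of_notMem_hub hG hS hvS hvA''
        have hiC : i ∈ petal S A v := by
          rw [← SimpleGraph.mem_neighborSet, hNv, Set.notMem_compl_iff] at hi
          exact hi.resolve_left hiA
        have hNi : G.neighborSet i = G.neighborSet v := by
          rw [neighborSet_of_notMem_hub hG hS hiC.1 hiA, hS.petal_eq hvA'' hiC, hNv]
        refine ⟨hNi.le, SimpleGraph.Adj.symm ?_⟩
        rw [← SimpleGraph.mem_neighborSet, hNi]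
        exact hvp
  funext i
  by_cases hi : G.Adj v i
  · exact hadj i hi
  · exact hD.apply_eq_zero_of_adj hd hp (hN i hi).2
      (total_eq_zero fun j hj => hadj j ((hN i hi).1 hj))

end Extraction

/-! ### Neighborhoods and cuts in tree gluings -/

section TreeGluing

variable {V ι : Type*} {G : SimpleGraph V} {S : ι → G.Subgraph} {A : ι → Set V}

/-- The graph is the union of the graphs `S α`, with nonempty inner hubs `A α`, which are glued on
cliques along a tree. -/
structure IsTreeGluing (S : ι → G.Subgraph) (A : ι → Set V) : Prop where
  hub : ∀ α, IsInnerHub (S α) (A α)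
  hub_nonempty : ∀ α, (A α).Nonempty
  iSup_eq : ⨆ α, S α = ⊤
  hub_disjoint : ∀ α β, α ≠ β → A α ∩ A β = ∅
  inter : ∀ α β, α ≠ β → (S α).verts ∩ (S β).verts = ∅ ∨ Glued (S α) (S β) ∨
    ∃ δ, δ ≠ α ∧ δ ≠ β ∧ (S α).verts ∩ (S β).verts = A δ
  isTree : (gluingGraph S).IsTree

theorem Glued.isMaximalClique_inter {S T : G.Subgraph} (h : Glued S T) :
    IsMaximalClique S (S.verts ∩ T.verts) ∧ IsMaximalClique T (S.verts ∩ T.verts) := by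
  obtain ⟨C, h1, h2, h3⟩ := h
  rw [h3]
  exact ⟨h1, h2⟩

namespace IsTreeGluing

theorem adj_iff (h : IsTreeGluing S A) {s t : V} : G.Adj s t ↔ ∃ α, (S α).Adj s t := by
  rw [← SimpleGraph.Subgraph.iSup_adj, h.iSup_eq, SimpleGraph.Subgraph.top_adj]

theorem exists_mem_verts (h : IsTreeGluing S A) (v : V) : ∃ α, v ∈ (S α).verts := by
  have : v ∈ (⨆ α, S α).verts := by rw [h.iSup_eq]; trivial
  simpa [SimpleGraph.Subgraph.verts_iSup] using this

theorem eq_of_mem_hub (h : IsTreeGluing S A) {α β : ι} {v : V} (hα : v ∈ A α) (hβ : v ∈ A β) :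
    α = β := by
  by_contra hne
  exact (h.hub_disjoint α β hne).subset ⟨hα, hβ⟩

/-- Disjointness of the hubs rules out that the intersection is a third hub. -/
theorem glued_of_mem_hub (h : IsTreeGluing S A) [Finite V] {α β : ι} (hne : α ≠ β) {v : V}
    (hα : v ∈ A α) (hβ : v ∈ (S β).verts) : Glued (S α) (S β) := by
  have hv : v ∈ (S α).verts ∩ (S β).verts := ⟨(h.hub α).subset_verts hα, hβ⟩
  rcases h.inter α β hne with h1 | h1 | ⟨δ, hδ, -, h1⟩
  · exact absurd hv (h1 ▸ Set.notMem_empty v)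
  · exact h1
  · exact absurd (h.eq_of_mem_hub (h1 ▸ hv) hα) hδ

theorem glued_or_mem_hub (h : IsTreeGluing S A) {α β : ι} (hne : α ≠ β) {v : V}
    (hα : v ∈ (S α).verts) (hβ : v ∈ (S β).verts) :
    Glued (S α) (S β) ∨ ∃ δ, δ ≠ α ∧ δ ≠ β ∧ v ∈ A δ := by
  have hv : v ∈ (S α).verts ∩ (S β).verts := ⟨hα, hβ⟩
  rcases h.inter α β hne with h1 | h1 | ⟨δ, hδ, hδ', h1⟩
  · exact absurd hv (h1 ▸ Set.notMem_empty v)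
  · exact Or.inl h1
  · exact Or.inr ⟨δ, hδ, hδ', h1 ▸ hv⟩

/-- Every edge of a tree is a bridge; `B` is the component of `β` after its removal. -/
theorem exists_branch (h : IsTreeGluing S A) {α β : ι} (hαβ : (gluingGraph S).Adj α β) :
    ∃ B : Set ι, β ∈ B ∧ α ∉ B ∧
      ∀ γ ∈ B, ∀ δ ∉ B, (gluingGraph S).Adj γ δ → γ = β ∧ δ = α := by
  have hbr := SimpleGraph.isAcyclic_iff_forall_adj_isBridge.1 h.isTree.isAcyclic hαβ
  rw [SimpleGraph.isBridge_iff] at hbr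
  refine ⟨{γ | ((gluingGraph S).deleteEdges {s(α, β)}).Reachable β γ}, .refl _,
    fun hα => hbr hα.symm, fun γ hγ δ hδ hγδ => ?_⟩
  by_cases he : s(γ, δ) = s(α, β)
  · rcases Sym2.eq_iff.1 he with ⟨rfl, rfl⟩ | ⟨rfl, rfl⟩
    · exact absurd (SimpleGraph.Reachable.symm hγ) hbr
    · exact ⟨rfl, rfl⟩
  · refine absurd (SimpleGraph.Reachable.trans hγ (SimpleGraph.Adj.reachable ?_)) hδ
    rw [SimpleGraph.deleteEdges_adj]
    exact ⟨hγδ, he⟩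

theorem not_triangle (h : IsTreeGluing S A) {α β γ : ι} (hαβ : (gluingGraph S).Adj α β)
    (hβγ : (gluingGraph S).Adj β γ) (hγα : (gluingGraph S).Adj γ α) : False := by
  obtain ⟨B, hβ, hα, hB⟩ := h.exists_branch hαβ
  by_cases hγ : γ ∈ B
  · exact hβγ.ne (hB γ hγ α hα hγα).1.symm
  · exact hγα.ne (hB β hβ γ hγ hβγ).2

variable [Finite V]

theorem inter_eq (h : IsTreeGluing S A) {α β : ι} (hG : Glued (S α) (S β)) {v : V}
    (hα : v ∈ (S α).verts) (hβ : v ∈ (S β).verts) (hv : v ∉ A α) :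
    (S α).verts ∩ (S β).verts = A α ∪ petal (S α) (A α) v :=
  (h.hub α).isMaximalClique_eq hG.isMaximalClique_inter.1 ⟨hα, hβ⟩ hv

/-- Any other `S δ` containing `v` is glued to `S α` on the only maximal clique of `S δ` through
`v`, so it brings no new neighbor. -/
theorem neighborSet_of_mem_hub (h : IsTreeGluing S A) {α : ι} {v : V} (hv : v ∈ A α) :
    G.neighborSet v = (S α).verts \ {v} := by
  ext t
  rw [SimpleGraph.mem_neighborSet, h.adj_iff, ← (h.hub α).adj_iff_of_mem hv]
  refine ⟨fun ⟨δ, hδ⟩ => ?_, fun ht => ⟨α, ht⟩⟩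
  by_cases hne : α = δ
  · exact hne ▸ hδ
  have hvδ : v ∉ A δ := fun h' => hne (h.eq_of_mem_hub hv h')
  have hvS := (h.hub α).subset_verts hv
  have heq := h.inter_eq (h.glued_of_mem_hub hne hv hδ.fst_mem).symm hδ.fst_mem hvS hvδ
  have ht := ((h.hub δ).adj_iff_of_notMem hδ.fst_mem hvδ).1 hδ
  rw [← heq] at ht
  exact ((h.hub α).adj_iff_of_mem hv).2 ⟨ht.1.2, ht.2⟩

theorem neighborSet_of_notMem_hub (h : IsTreeGluing S A) {α : ι} {v : V} (hvα : v ∈ (S α).verts)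
    (hv : ∀ δ, v ∉ A δ) : G.neighborSet v = (A α ∪ petal (S α) (A α) v) \ {v} := by
  ext t
  rw [SimpleGraph.mem_neighborSet, h.adj_iff, ← (h.hub α).adj_iff_of_notMem hvα (hv α)]
  refine ⟨fun ⟨δ, hδ⟩ => ?_, fun ht => ⟨α, ht⟩⟩
  by_cases hne : α = δ
  · exact hne ▸ hδ
  have hglued : Glued (S α) (S δ) := (h.glued_or_mem_hub hne hvα hδ.fst_mem).resolve_right
    fun ⟨l, _, _, hl⟩ => hv l hl
  have heq := h.inter_eq hglued hvα hδ.fst_mem (hv α)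
  have heq' := h.inter_eq hglued.symm hδ.fst_mem hvα (hv δ)
  have ht := ((h.hub δ).adj_iff_of_notMem hδ.fst_mem (hv δ)).1 hδ
  rw [← heq', Set.inter_comm, heq] at ht
  exact ((h.hub α).adj_iff_of_notMem hvα (hv α)).2 ht

theorem isCut_hub (h : IsTreeGluing S A) (α : ι) :
    IsCut G (A α) (A α) ((S α).verts \ A α) where
  left_subset := le_rfl
  right_subset := fun _ hx => hx.2
  adj_iff s hs t ht := by
    rw [← SimpleGraph.mem_neighborSet, h.neighborSet_of_mem_hub hs]
    have : t ≠ s := fun hts => ht (hts ▸ hs)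
    simp [hs, ht, this]

/-- A vertex outside the hub `A α`, common to a graph on the branch of `β` and to a graph outside
it. -/
theorem eq_and_mem_verts_of_branch (h : IsTreeGluing S A) {α β : ι} {B : Set ι}
    (hB : ∀ γ ∈ B, ∀ δ ∉ B, (gluingGraph S).Adj γ δ → γ = β ∧ δ = α) {w : V} (hw : w ∉ A α)
    {γ δ : ι} (hγ : γ ∈ B) (hδ : δ ∉ B) (hwγ : w ∈ (S γ).verts) (hwδ : w ∈ (S δ).verts) :
    δ = α ∧ w ∈ (S β).verts := by
  have hne : γ ≠ δ := fun hγδ => hδ (hγδ ▸ hγ)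
  rcases h.glued_or_mem_hub hne hwγ hwδ with h1 | ⟨l, hlγ, hlδ, hwl⟩
  · obtain ⟨rfl, rfl⟩ := hB γ hγ δ hδ ⟨hne, h1⟩
    exact ⟨rfl, hwγ⟩
  · by_cases hl : l ∈ B
    · obtain ⟨rfl, rfl⟩ := hB l hl δ hδ ⟨hlδ, h.glued_of_mem_hub hlδ hwl hwδ⟩
      exact ⟨rfl, (h.hub l).subset_verts hwl⟩
    · obtain ⟨-, rfl⟩ := hB γ hγ l hl ⟨hlγ.symm, (h.glued_of_mem_hub hlγ hwl hwγ).symm⟩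
      exact absurd hwl hw

/-- The part of the graph which hangs on a petal of `S α` is joined to the rest by the edges from
the petal to the hub. -/
theorem exists_isCut_petal (h : IsTreeGluing S A) {α : ι} {i : V} (hi : i ∈ (S α).verts)
    (hiA : i ∉ A α) : ∃ T, IsCut G T (petal (S α) (A α) i) (A α) ∧
      (S α).verts ∩ T = petal (S α) (A α) i := by
  set C := petal (S α) (A α) i with hC
  have hCA : ∀ s ∈ C, ∀ t ∈ A α, G.Adj s t := fun s hs t ht =>
    h.adj_iff.2 ⟨α, ((h.hub α).adj ht hs.1 fun hts => hs.2.1 (hts ▸ ht)).symm⟩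
  have hSα : ∀ s ∈ C, ∀ t, (S α).Adj s t → t ∈ A α ∪ C := fun s hs t hst => by
    have := (((h.hub α).adj_iff_of_notMem hs.1 hs.2.1).1 hst).1
    rwa [(h.hub α).petal_eq hiA hs] at this
  by_cases hex : ∃ β, β ≠ α ∧ Glued (S α) (S β) ∧ i ∈ (S β).verts
  · obtain ⟨β, hne, hglued, hiβ⟩ := hex
    obtain ⟨B, hβB, hαB, hB⟩ := h.exists_branch (α := α) (β := β) ⟨hne.symm, hglued⟩
    have hK := h.inter_eq hglued hi hiβ hiA
    have hCβ : C ⊆ (S β).verts := fun x hx =>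
      (hK.ge (Or.inr hx : x ∈ A α ∪ petal (S α) (A α) i)).2
    -- If some `S β` is glued on the clique of `i`, then `T` is everything on the branch of `β`,
    -- without the hub; otherwise the petal alone is a side of the cut.
    set T := (⋃ γ ∈ B, (S γ).verts) \ A α with hT
    have hCT : C ⊆ T := fun x hx => ⟨Set.mem_biUnion hβB (hCβ hx), hx.2.1⟩
    have hmemC : ∀ w ∈ T, w ∈ (S α).verts → w ∈ C := by
      rintro w ⟨hw, hwA⟩ hwα
      obtain ⟨γ, hγ, hwγ⟩ := Set.mem_iUnion₂.1 hw
      have hwβ := (h.eq_and_mem_verts_of_branch hB hwA hγ hαB hwγ hwα).2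
      exact (hK.le ⟨hwα, hwβ⟩).resolve_left hwA
    refine ⟨T, ⟨hCT, fun x hx hx' => hx'.2 hx, fun s hs t ht => ⟨fun hst => ?_, fun hst =>
      hCA s hst.1 t hst.2⟩⟩, ?_⟩
    · obtain ⟨γ, hγ, hsγ⟩ := Set.mem_iUnion₂.1 hs.1
      obtain ⟨δ, hδ⟩ := h.adj_iff.1 hst
      by_cases hδB : δ ∈ B
      · have htA : t ∈ A α := by
          by_contra htA
          exact ht ⟨Set.mem_biUnion hδB hδ.snd_mem, htA⟩
        have hsN : s ∈ G.neighborSet t := hst.symm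
        rw [h.neighborSet_of_mem_hub htA] at hsN
        exact ⟨hmemC s hs hsN.1, htA⟩
      · obtain ⟨rfl, -⟩ := h.eq_and_mem_verts_of_branch hB hs.2 hγ hδB hsγ hδ.fst_mem
        have hsC := hmemC s hs hδ.fst_mem
        exact ⟨hsC, (hSα s hsC t hδ).resolve_right fun htC => ht (hCT htC)⟩
    · ext x
      exact ⟨fun hx => hmemC x hx.2 hx.1, fun hx => ⟨hx.1, hCT hx⟩⟩
  · have honly : ∀ s ∈ C, ∀ β, s ∈ (S β).verts → β = α := by
      intro s hs β hsβ
      by_contra hne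
      have key : ∀ δ, δ ≠ α → Glued (S α) (S δ) → s ∈ (S δ).verts → False := by
        intro δ hδ hglued hsδ
        have hK := h.inter_eq hglued hs.1 hsδ hs.2.1
        rw [(h.hub α).petal_eq hiA hs] at hK
        exact hex ⟨δ, hδ, hglued, (hK.ge (Or.inr ⟨hi, hiA, Or.inl rfl⟩)).2⟩
      rcases h.glued_or_mem_hub (Ne.symm hne) hs.1 hsβ with h1 | ⟨l, hl, -, hsl⟩
      · exact key β hne h1 hsβ
      · exact key l hl (h.glued_of_mem_hub hl hsl hs.1).symm ((h.hub l).subset_verts hsl)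
    refine ⟨C, ⟨le_rfl, fun x hx hx' => hx'.2.1 hx, fun s hs t ht => ⟨fun hst => ?_, fun hst =>
      hCA s hst.1 t hst.2⟩⟩, Set.inter_eq_right.2 fun x hx => hx.1⟩
    obtain ⟨δ, hδ⟩ := h.adj_iff.1 hst
    obtain rfl := honly s hs δ hδ.fst_mem
    exact ⟨hs, (hSα s hs t hδ).resolve_right ht⟩

end IsTreeGluing

end TreeGluing

/-! ### Propagation of zeros along the tree -/

section TreeExchange

variable {V ι : Type*} [Fintype V] {G : SimpleGraph V} {S : ι → G.Subgraph} {A : ι → Set V}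
  {E : Type*} [NormedAddCommGroup E] [InnerProductSpace ℝ E] {R : Set V} {D : Set (V → E)}
  {d : V → E}

namespace IsTreeGluing

theorem eq_zero_on_hub (h : IsTreeGluing S A) (hD : IsExchangeable G R D) (hd : d ∈ D) {α : ι}
    (hA : total d (A α) = 0) {i : V} (hi : i ∈ A α) : d i = 0 := by
  have hd' := hD.indicator_mem_of_left hd (h.isCut_hub α) hA
  have hsub := (h.hub α).subset_verts
  have htot : total ((A α).indicator d) (S α).verts = 0 := by
    rw [total_indicator, Set.inter_eq_right.2 hsub, hA]
  have h1 := hD.apply_eq_zero hd' htot (hsub hi) (h.neighborSet_of_mem_hub hi)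
  rwa [Set.indicator_of_mem hi] at h1

/-- The regular hub vertex `v` gives total zero on `S α`, and the hub cut then gives total zero on
the hub. Hence `d` may be truncated to the part hanging on a petal, and `v` sees that the petal has
total zero as well. -/
theorem eq_zero_on_verts (h : IsTreeGluing S A) (hD : IsExchangeable G R D) (hd : d ∈ D) {α : ι}
    {v : V} (hvA : v ∈ A α) (hv : v ∈ R) (hdv : d v = 0) {i : V} (hi : i ∈ (S α).verts) :
    d i = 0 := by
  have hsub := (h.hub α).subset_verts
  have hN := h.neighborSet_of_mem_hub hvA
  have htot := hD.total_eq_zero_of_mem hd hv hdv (hsub hvA) hN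
  have hA : total d (A α) = 0 := by
    refine hD.total_left_eq_zero hd (h.isCut_hub α) ?_
    rw [← htot, ← total_inter_add_diff d (S α).verts (A α), Set.inter_eq_right.2 hsub]
  by_cases hiA : i ∈ A α
  · exact h.eq_zero_on_hub hD hd hA hiA
  set C := petal (S α) (A α) i with hC
  have hdisj : Disjoint (A α) C := Set.disjoint_left.2 fun x hx hx' => hx'.2.1 hx
  have hCtot : total d C = 0 := by
    obtain ⟨T, hT, hTC⟩ := h.exists_isCut_petal hi hiA
    have hd' := hD.indicator_mem_of_right hd hT hA
    have hdv' : T.indicator d v = 0 := by simp [hdv]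
    have := hD.total_eq_zero_of_mem hd' hv hdv' (hsub hvA) hN
    rwa [total_indicator, hTC] at this
  have hnon : ∀ j ∈ C, (∀ δ, j ∉ A δ) → d j = 0 := fun j hj hjA => by
    refine hD.apply_eq_zero hd (K := A α ∪ C) ?_ (Or.inr hj) ?_
    · rw [total_union hdisj, hA, hCtot, add_zero]
    · rw [h.neighborSet_of_notMem_hub hj.1 hjA, (h.hub α).petal_eq hiA hj]
  have hiC : i ∈ C := ⟨hi, hiA, Or.inl rfl⟩
  by_cases hihub : ∀ δ, i ∉ A δ
  · exact hnon i hiC hihub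
  push Not at hihub
  obtain ⟨β, hiβ⟩ := hihub
  have hne : β ≠ α := fun hβα => hiA (hβα ▸ hiβ)
  have hglued := h.glued_of_mem_hub hne hiβ hi
  have hK := h.inter_eq hglued.symm hi ((h.hub β).subset_verts hiβ) hiA
  have hβC : A β ⊆ C := fun x hx => by
    have hx' := (h.hub β).subset_isMaximalClique hglued.symm.isMaximalClique_inter.2 hx
    rw [hK] at hx'
    exact hx'.resolve_left fun hxα => hne (h.eq_of_mem_hub hx hxα)
  refine h.eq_zero_on_hub hD hd (α := β) ?_ hiβ
  -- A second hub meeting the petal would close a triangle in the gluing tree, so the total over `A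
  -- β` is that over the petal.
  have hrest : total d (C \ A β) = 0 := total_eq_zero fun j hj => hnon j hj.1 fun δ hjδ => by
    have hδβ : δ ≠ β := fun hδ => hj.2 (hδ ▸ hjδ)
    have hδα : δ ≠ α := fun hδ => hj.1.2.1 (hδ ▸ hjδ)
    have hjβ : j ∈ (S β).verts := (hK.ge (Or.inr hj.1 : j ∈ A α ∪ C)).2
    exact h.not_triangle (α := α) (β := β) (γ := δ) ⟨hne.symm, hglued.symm⟩
      ⟨hδβ.symm, (h.glued_of_mem_hub hδβ hjδ hjβ).symm⟩
      ⟨hδα, h.glued_of_mem_hub hδα hjδ hj.1.1⟩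
  rw [← total_inter_add_diff d C (A β), hrest, add_zero, Set.inter_eq_right.2 hβC] at hCtot
  exact hCtot

/-- Exchangeable families for graphs with inner hubs glued along a tree. -/
theorem eq_zero (h : IsTreeGluing S A) (hD : IsExchangeable G R D) (hd : d ∈ D)
    (hR : ∀ α, ∃ p ∈ A α, p ∈ R) {v : V} (hv : v ∈ R) (hdv : d v = 0) : d = 0 := by
  have hstart : ∃ α, ∀ i ∈ (S α).verts, d i = 0 := by
    by_cases hvhub : ∃ α, v ∈ A α
    · obtain ⟨α, hα⟩ := hvhub
      exact ⟨α, fun i hi => h.eq_zero_on_verts hD hd hα hv hdv hi⟩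
    push Not at hvhub
    -- If `v` is in no hub, its closed neighborhood is hub plus petal, with total zero. The petal
    -- cut gives total zero on the hub, and a regular hub vertex takes over.
    obtain ⟨α, hvα⟩ := h.exists_mem_verts v
    obtain ⟨T, hT, -⟩ := h.exists_isCut_petal hvα (hvhub α)
    have hdisj : Disjoint (A α) (petal (S α) (A α) v) :=
      Set.disjoint_left.2 fun x hx hx' => hx'.2.1 hx
    have hK := hD.total_eq_zero_of_mem hd hv hdv (Or.inr ⟨hvα, hvhub α, Or.inl rfl⟩)
      (h.neighborSet_of_notMem_hub hvα hvhub)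
    rw [total_union hdisj, add_comm] at hK
    have hA := hD.total_right_eq_zero hd hT hK
    obtain ⟨p, hpA, hp⟩ := hR α
    exact ⟨α, fun i hi =>
      h.eq_zero_on_verts hD hd hpA hp (h.eq_zero_on_hub hD hd hA hpA) hi⟩
  obtain ⟨α, hα⟩ := hstart
  -- The hub of `S γ` is contained in the gluing clique, hence in `S β`.
  have hstep : ∀ β γ, (gluingGraph S).Adj β γ → (∀ i ∈ (S β).verts, d i = 0) →
      ∀ i ∈ (S γ).verts, d i = 0 := by
    intro β γ hβγ hβ i hi
    obtain ⟨p, hpA, hp⟩ := hR γ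
    have hpβ := ((h.hub γ).subset_isMaximalClique hβγ.2.isMaximalClique_inter.2 hpA).1
    exact h.eq_zero_on_verts hD hd hpA hp (hβ p hpβ) hi
  have hall : ∀ β, ∀ i ∈ (S β).verts, d i = 0 := by
    intro β
    obtain ⟨w⟩ := h.isTree.connected.preconnected α β
    induction w with
    | nil => exact hα
    | cons hadj _ ih => exact ih (hstep _ _ hadj hα)
  funext i
  obtain ⟨β, hβ⟩ := h.exists_mem_verts i
  exact hall β i hβ

end IsTreeGluing

end TreeExchange

/-! ### Single hubs and stars as tree gluings -/

section Cases

variable {V : Type*} {G : SimpleGraph V}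

theorem isTreeGluing_of_isInnerHub {A : Set V} (h : IsInnerHub (⊤ : G.Subgraph) A)
    (hA : A.Nonempty) : IsTreeGluing (fun _ : Unit => (⊤ : G.Subgraph)) fun _ => A where
  hub _ := h
  hub_nonempty _ := hA
  iSup_eq := ciSup_const
  hub_disjoint α β hne := absurd (Subsingleton.elim α β) hne
  inter α β hne := absurd (Subsingleton.elim α β) hne
  isTree := SimpleGraph.IsTree.of_subsingleton

theorem isTreeGluing_star {ι : Type*} {S : ι → G.Subgraph} {A : ι → Set V} {o : ι} {E : Set ι}
    (ho : o ∉ E) (hub : ∀ α ∈ insert o E, IsInnerHub (S α) (A α)) (ho' : (A o).Nonempty)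
    (hA : ∀ α ∈ E, (A α).Nonempty ∧ A α ∩ A o = ∅) (hsup : (⨆ α ∈ insert o E, S α) = ⊤)
    (hglued : ∀ α ∈ E, Glued (S α) (S o))
    (hinter : ∀ α ∈ E, ∀ β ∈ E, α ≠ β → (S α).verts ∩ (S β).verts = A o) :
    IsTreeGluing (fun α : ↥(insert o E) => S α) fun α => A α := by
  have hne : ∀ α ∈ E, α ≠ o := fun α hα h => ho (h ▸ hα)
  have hAα : ∀ α ∈ E, ∀ C, IsMaximalClique (S α) C → A α ⊆ C := fun α hα C hC =>
    (hub α (Or.inr hα)).subset_isMaximalClique hC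
  -- If two leaves were glued, `A o` would be a maximal clique of `S α` and contain the nonempty `A
  -- α`, which is disjoint from it. So the gluing graph is exactly a star.
  have hAE : ∀ α ∈ E, ∀ β ∈ E, α ≠ β → ¬ Glued (S α) (S β) := by
    intro α hα β hβ hαβ hg
    have h1 := hg.isMaximalClique_inter.1
    rw [hinter α hα β hβ hαβ] at h1
    obtain ⟨x, hx⟩ := (hA α hα).1
    exact (hA α hα).2.subset ⟨hx, hAα α hα _ h1 hx⟩
  have hverts : ∀ α ∈ E, A α ⊆ (S α).verts := fun α hα x hx => by
    obtain ⟨C, hC, -⟩ := hglued α hα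
    exact hC.subset (hAα α hα C hC hx)
  refine ⟨fun α => hub α α.2, ?_, ?_, ?_, ?_, ?_⟩
  · rintro ⟨α, rfl | hα⟩
    · exact ho'
    · exact (hA α hα).1
  · rw [← hsup, iSup_subtype']
  · rintro ⟨α, rfl | hα⟩ ⟨β, rfl | hβ⟩ hαβ
    · exact absurd rfl hαβ
    · rw [Set.inter_comm]; exact (hA β hβ).2
    · exact (hA α hα).2
    · have hαβ' : α ≠ β := fun h => hαβ (Subtype.ext h)
      refine Set.eq_empty_of_forall_notMem fun x hx => (hA α hα).2.subset ⟨hx.1, ?_⟩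
      exact hinter α hα β hβ hαβ' ▸ ⟨hverts α hα hx.1, hverts β hβ hx.2⟩
  · rintro ⟨α, rfl | hα⟩ ⟨β, rfl | hβ⟩ hαβ
    · exact absurd rfl hαβ
    · exact Or.inr (Or.inl (hglued β hβ).symm)
    · exact Or.inr (Or.inl (hglued α hα))
    · have hαβ' : α ≠ β := fun h => hαβ (Subtype.ext h)
      exact Or.inr (Or.inr ⟨⟨o, Or.inl rfl⟩, fun h => hne α hα (congrArg Subtype.val h).symm,
        fun h => hne β hβ (congrArg Subtype.val h).symm, hinter α hα β hβ hαβ'⟩)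
  · have : gluingGraph (fun α : ↥(insert o E) => S α) =
        SimpleGraph.starGraph (⟨o, Or.inl rfl⟩ : ↥(insert o E)) := by
      ext α β
      rw [SimpleGraph.starGraph_adj]
      refine and_congr_right fun hαβ => ?_
      obtain ⟨α, rfl | hα⟩ := α <;> obtain ⟨β, rfl | hβ⟩ := β
      · exact absurd rfl hαβ
      · exact ⟨fun _ => Or.inl rfl, fun _ => (hglued β hβ).symm⟩
      · exact ⟨fun _ => Or.inr rfl, fun _ => hglued α hα⟩
      · have hαβ' : α ≠ β := fun h => hαβ (Subtype.ext h)
        refine ⟨fun h => absurd h (hAE α hα β hβ hαβ'), ?_⟩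
        rintro (h | h)
        · exact absurd (congrArg Subtype.val h) (hne α hα)
        · exact absurd (congrArg Subtype.val h) (hne β hβ)
    rw [this]
    exact SimpleGraph.isTree_starGraph _

end Cases

end GraphOT

theorem mainTheorem6 {V : Type*} [Fintype V] {n : ℕ}
    (X : V → Set (EuclideanSpace ℝ (Fin n)))
    (hXo : ∀ v, IsOpen (X v)) (hXb : ∀ v, Bornology.IsBounded (X v))
    (μ : (v : V) → MeasureTheory.Measure (X v))
    (hμ : ∀ v, MeasureTheory.IsProbabilityMeasure (μ v))
    (G : SimpleGraph V) (v₁ : V)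
    (h : GraphOT.ExtractionHypotheses G v₁ μ ∨ GraphOT.InnerHubHypotheses G v₁ μ ∨
      GraphOT.StarGluingHypotheses G v₁ μ ∨ GraphOT.TreeGluingHypotheses G v₁ μ) :
    ∃! γ : MeasureTheory.Measure ((v : V) → X v), GraphOT.IsKantorovichSolution G μ γ := by
  refine GraphOT.existsUnique_isKantorovichSolution hXo hXb μ hμ v₁ fun D hD d hd hdv => ?_
  rcases h with h | h | h | h
  · obtain ⟨S, A, hS, rfl, -, hv₁, h⟩ := h
    refine GraphOT.eq_zero_of_extraction (S := S) (fun s t => ?_) hS hD hd hv₁ hdv h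
    simp
  · obtain ⟨A, hA, hv₁, p, hpA, hp⟩ := h
    exact (GraphOT.isTreeGluing_of_isInnerHub hA ⟨p, hpA⟩).eq_zero hD hd
      (fun _ => ⟨p, hpA, hp⟩) hv₁ hdv
  · obtain ⟨l, K, E, S, A, -, -, h0, hub, hA, hsup, hglued, hinter, hR, hv₁, -⟩ := h
    obtain ⟨p, hp, -⟩ := hR 0 (Or.inl rfl)
    exact (GraphOT.isTreeGluing_star h0 hub ⟨p, hp⟩ hA hsup hglued hinter).eq_zero hD hd
      (fun α => hR α α.2) hv₁ hdv
  · obtain ⟨l, S, A, hub, hsup, -, hpair, hv₁, hR, -, htree⟩ := h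
    have hT : GraphOT.IsTreeGluing S A := ⟨hub, fun α => (hR α).imp fun _ hp => hp.1, hsup,
      fun α β hne => (hpair α β hne).1, fun α β hne => (hpair α β hne).2, htree⟩
    exact hT.eq_zero hD hd hR hv₁ hdv
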